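/- Let $n\in\mathbb N$, let $\mathcal L(\mathbb R^n)$ be the $n\times n$ real matrices with the operator norm, and let $\omega>0$. For $a<b$, $\int_a^b \mathrm d[A(s)]g(s)$ denotes the Kurzweil–Stieltjes integral: the vector $X$ such that for every $\varepsilon>0$ there is a gauge $\delta:[a,b]\to(0,\infty)$ with $\bigl\|\sum_j [A(\alpha_j)-A(\alpha_{j-1})]g(\tau_j)-X\bigr\|<\varepsilon$ for every $\delta$-fine tagged partition $a=\alpha_0<\dots<\alpha_\nu=b$, $\tau_j\in[\alpha_{j-1},\alpha_j]\subset(\tau_j-\delta(\tau_j),\tau_j+\delta(\tau_j))$; also $\int_b^a=-\int_a^b$ and $\int_a^a=0$. Let $A:\mathbb R\to\mathcal L(\mathbb R^n)$ be of locally bounded variation, let $C\in\mathcal L(\mathbb R^n)$ be a constant matrix with $A(t+\omega)-A(t)=C$ for all $t\in\mathbb R$, and let $f:\mathbb R\to\mathbb R^n$ be $\omega$-periodic and regulated (that is, it has finite one-sided limits at every point). Assume (H) the matrices $I-[A(t)-A(t^-)]$ and $I+[A(t^+)-A(t)]$ are invertible for all $t\in\mathbb R$. A solution of $\frac{dx}{d\tau}=D[A(t)x+f(t)]$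 is a function $x:\mathbb R\to\mathbb R^n$ such that, for all $s,t\in\mathbb R$, the integral below exists and $x(t)=x(s)+\int_s^t\mathrm d[A(r)]x(r)+f(t)-f(s)$. The transition matrix of the homogeneous equation $\frac{dx}{d\tau}=D[A(t)x]$ is the function $U:\mathbb R\times\mathbb R\to\mathcal L(\mathbb R^n)$, existing and unique under these assumptions, with $U(t,s)=I+\int_s^t\mathrm d[A(r)]U(r,s)$ for all $t,s\in\mathbb R$ (columnwise). Assume that the homogeneous equation has an exponential dichotomy on $\mathbb R$: with $\mathcal U(t)=U(t,0)$ there are $K,\alpha>0$ and a projection $P=P^2\in\mathcal L(\mathbb R^n)$ such that $$\|\mathcal U(t)P\,\mathcal U^{-1}(s)\|\le Ke^{-\alpha(t-s)}\ (t\ge s),\qquad \|\mathcal U(t)(I-P)\,\mathcal U^{-1}(s)\|\le Ke^{-\alpha(s-t)}\ (s\ge t).$$ Then the inhomogeneous equation $\frac{dx}{d\tau}=D[A(t)x+f(t)]$ has exactly one $\omega$-periodic solution, and this solution is regulated. Moreover $I-U(\omega,0)$ is invertible, the integral $\int_0^\omega\mathrm d[U(\omega,s)](f(s)-f(0))$ exists,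 and the $\omega$-periodic solution is the unique solution of the equation with initial value $$x(0)=-[I-U(\omega,0)]^{-1}\int_0^\omega \mathrm d[U(\omega,s)]\,(f(s)-f(0)).$$ -/

import Mathlib

open Filter Topology

noncomputable section

namespace GLDE

variable {E : Type*} [NormedAddCommGroup E] [NormedSpace ℝ E]

/-- A function on `ℝ` is regulated if it has one-sided limits (with values in `X`) at every
point; equivalently, its restriction to every compact interval is regulated. -/
def IsRegulated {X : Type*} [TopologicalSpace X] (φ : ℝ → X) : Prop :=
  ∀ t : ℝ, (∃ y, Tendsto φ (𝓝[<] t) (𝓝 y)) ∧ (∃ y, Tendsto φ (𝓝[>] t) (𝓝 y))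

/-- The points `α 0 < ⋯ < α ν` with the tags `τ 0, …, τ (ν - 1)` form a tagged partition of
`[a, b]`. -/
def IsTaggedPartition (a b : ℝ) (ν : ℕ) (α τ : ℕ → ℝ) : Prop :=
  α 0 = a ∧ α ν = b ∧ ∀ j < ν, α j < α (j + 1) ∧ τ j ∈ Set.Icc (α j) (α (j + 1))

/-- `δ`-fineness of a tagged partition. -/
def IsFine (δ : ℝ → ℝ) (ν : ℕ) (α τ : ℕ → ℝ) : Prop :=
  ∀ j < ν, Set.Icc (α j) (α (j + 1)) ⊆ Set.Ioo (τ j - δ (τ j)) (τ j + δ (τ j))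

/-- `X` is the Kurzweil–Stieltjes integral `∫_a^b d[A(s)] g(s)`, in the case `a ≤ b`. -/
def HasKSIntegralOn (A : ℝ → E →L[ℝ] E) (g : ℝ → E) (a b : ℝ) (X : E) : Prop :=
  ∀ ε > 0, ∃ δ : ℝ → ℝ, (∀ t ∈ Set.Icc a b, 0 < δ t) ∧
    ∀ (ν : ℕ) (α τ : ℕ → ℝ), IsTaggedPartition a b ν α τ → IsFine δ ν α τ →
      ‖∑ j ∈ Finset.range ν, (A (α (j + 1)) - A (α j)) (g (τ j)) - X‖ < ε

/-- `∫_a^b d[A(s)] g(s)` exists and equals `X`, for `a` and `b` in any order, with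
`∫_a^b = -∫_b^a`. If `a = b`, both clauses say that `X = 0`. -/
def HasKSIntegral (A : ℝ → E →L[ℝ] E) (g : ℝ → E) (a b : ℝ) (X : E) : Prop :=
  (a ≤ b → HasKSIntegralOn A g a b X) ∧ (b ≤ a → HasKSIntegralOn A g b a (-X))

/-- `x` is a solution on `ℝ` of `dx/dτ = D[A(t)x + f(t)]`, that is,
`x(t) = x(s) + ∫_s^t d[A(r)] x(r) + f(t) - f(s)` for all `s` and `t`, where the integral is
required to exist. -/
def IsSolution (A : ℝ → E →L[ℝ] E) (f x : ℝ → E) : Prop :=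
  ∀ s t : ℝ, HasKSIntegral A x s t (x t - x s - (f t - f s))

/-- Condition (H): `I - Δ⁻A(t)` and `I + Δ⁺A(t)` are invertible for all `t`. -/
def ConditionH (A : ℝ → E →L[ℝ] E) : Prop :=
  ∀ t : ℝ, IsUnit (1 - (A t - Function.leftLim A t)) ∧
    IsUnit (1 + (Function.rightLim A t - A t))

/-- `U(t,s) = I + ∫_s^t d[A(r)] U(r,s)` for all `t` and `s`, read on each vector. -/
def IsTransitionMatrix (A : ℝ → E →L[ℝ] E) (U : ℝ → ℝ → E →L[ℝ] E) : Prop :=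
  ∀ (t s : ℝ) (v : E), HasKSIntegral A (fun r => U r s v) s t (U t s v - v)

open Classical in
/-- The transition matrix of `dx/dτ = D[A(t)x]` (with the junk value `0` where none exists). -/
def transitionMatrix (A : ℝ → E →L[ℝ] E) : ℝ → ℝ → E →L[ℝ] E :=
  if h : ∃ U, IsTransitionMatrix A U then h.choose else 0

/-- Exponential dichotomy on `ℝ` of `dx/dτ = D[A(t)x]`. -/
def HasExpDichotomy (A : ℝ → E →L[ℝ] E) : Prop :=
  ∃ (K α : ℝ) (P : E →L[ℝ] E), 0 < K ∧ 0 < α ∧ P * P = P ∧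
    (∀ t s : ℝ, s ≤ t →
      ‖transitionMatrix A t 0 * P * Ring.inverse (transitionMatrix A s 0)‖
        ≤ K * Real.exp (-α * (t - s))) ∧
    (∀ t s : ℝ, t ≤ s →
      ‖transitionMatrix A t 0 * (1 - P) * Ring.inverse (transitionMatrix A s 0)‖
        ≤ K * Real.exp (-α * (s - t)))

end GLDE

end

/-!
Let `M` be monotone with increments dominating those of `A` and jumping wherever `f` does. In
terms of `M`, the integral equation is a differential one: `F` is an indefinite integral of
`d[A] g` iff `F v - F τ - (A v - A τ) (g τ) = o(M v - M τ)` as `v → τ`, for every `τ`. Statements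
about an interval can then be proved by Cousin's lemma from statements about short one-sided
neighbourhoods of each point. This gives both the uniqueness and the existence of solutions: where
`M` varies little the Picard iteration contracts, and the possible jump at the endpoint is
inverted by (H).

If `x` solves the inhomogeneous equation, the product rule shows that
`s ↦ U(ω,s) (f s - f 0 - x s)` is an indefinite integral of `d[U(ω,s)] (f s - f 0)`, so that
`∫_0^ω d[U(ω,s)] (f s - f 0) = f ω - f 0 - x ω + U(ω,0) (x 0)`. As `A(t + ω) - A(t)` is constant,
a solution is periodic iff `x ω = x 0`, which is thus a linear equation for `x 0` with operator
`1 - U(ω,0)`. Finally `U(kω,0) = φ^k` with `φ = U(ω,0)`, so the dichotomy bounds make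
`∑_{k ≥ 0} φ^k P` and `∑_{k ≥ 1} φ^{-k} (1 - P)` converge; the difference of these two sums is an
inverse of `1 - φ`.
-/

namespace GLDE

open Set Asymptotics MeasureTheory
open scoped UniformConvergence

section KurzweilStieltjes

theorem cousin_induction {Q : ℝ → ℝ → Prop} {a b : ℝ} (hab : a < b)
    (trans : ∀ u v w, a ≤ u → u < v → v < w → w ≤ b → Q u v → Q v w → Q u w)
    (right : ∀ τ ∈ Ico a b, ∀ᶠ v in 𝓝[>] τ, Q τ v)
    (left : ∀ τ ∈ Ioc a b, ∀ᶠ u in 𝓝[<] τ, Q u τ) : Q a b := by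
  let s : Set ℝ := {t | ∀ r ∈ Ioc a t, Q a r}
  suffices b ∈ s from this b ⟨hab, le_rfl⟩
  refine IsClosed.mem_of_ge_of_forall_exists_gt (a := a) ?_ (fun r hr => by grind) hab.le ?_
  · refine isClosed_of_closure_subset fun t ht => ?_
    have htab : t ∈ Icc a b := closure_minimal inter_subset_right isClosed_Icc ht
    have below : ∀ r ∈ Ioo a t, Q a r := fun r hr => by
      obtain ⟨t', hrt', ht', -⟩ := mem_closure_iff.1 ht _ isOpen_Ioi hr.2
      exact ht' r ⟨hr.1, hrt'.le⟩
    refine ⟨fun r hr => ?_, htab⟩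
    rcases hr.2.lt_or_eq with hrt | rfl
    · exact below r ⟨hr.1, hrt⟩
    · obtain ⟨u, hQ, hu⟩ := ((left r ⟨hr.1, htab.2⟩).and (Ioo_mem_nhdsLT hr.1)).exists
      exact trans a u r le_rfl hu.1 hu.2 htab.2 (below u hu) hQ
  · rintro t ⟨hts, htab⟩
    obtain ⟨w, htw, hw⟩ := mem_nhdsGT_iff_exists_Ioc_subset.1 (right t htab)
    refine ⟨min w b, fun r hr => ?_, lt_min htw htab.2, min_le_right _ _⟩
    rcases le_or_gt r t with hrt | hrt
    · exact hts r ⟨hr.1, hrt⟩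
    · have hQ : Q t r := hw ⟨hrt, hr.2.trans (min_le_left _ _)⟩
      rcases htab.1.eq_or_lt with rfl | hat
      · exact hQ
      · exact trans a t r le_rfl hat hrt (hr.2.trans (min_le_right _ _)) (hts t ⟨hat, le_rfl⟩) hQ

variable {E : Type*} [NormedAddCommGroup E] [NormedSpace ℝ E]

/-- `IsRiemannSum A g δ a b X` says that `X` is the integral sum of some `δ`-fine tagged partition
of `[a, b]`; the partition is built up from left to right, one tagged interval at a time. -/
inductive IsRiemannSum (A : ℝ → E →L[ℝ] E) (g : ℝ → E) (δ : ℝ → ℝ) (a : ℝ) : ℝ → E → Prop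
  | refl : IsRiemannSum A g δ a a 0
  | snoc {b c t : ℝ} {X : E} (h : IsRiemannSum A g δ a b X) (hbc : b < c) (ht : t ∈ Icc b c)
      (hδ : Icc b c ⊆ Ioo (t - δ t) (t + δ t)) :
      IsRiemannSum A g δ a c (X + (A c - A b) (g t))

variable {A : ℝ → E →L[ℝ] E} {g : ℝ → E} {δ δ' : ℝ → ℝ} {a b c t ω : ℝ} {X Y : E}

namespace IsRiemannSum

theorem le (h : IsRiemannSum A g δ a b X) : a ≤ b := by
  induction h with
  | refl => exact le_rfl
  | snoc _ hbc _ _ ih => exact ih.trans hbc.le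

theorem single (hab : a < b) (ht : t ∈ Icc a b) (hδ : Icc a b ⊆ Ioo (t - δ t) (t + δ t)) :
    IsRiemannSum A g δ a b ((A b - A a) (g t)) := by
  simpa only [zero_add] using (refl (A := A) (g := g)).snoc hab ht hδ

theorem single_left (hab : a < b) (hδ : b < a + δ a) :
    IsRiemannSum A g δ a b ((A b - A a) (g a)) :=
  single hab (left_mem_Icc.2 hab.le) fun r hr => ⟨by linarith [hr.1], by linarith [hr.2]⟩

theorem single_right (hab : a < b) (hδ : b - δ b < a) :
    IsRiemannSum A g δ a b ((A b - A a) (g b)) :=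
  single hab (right_mem_Icc.2 hab.le) fun r hr => ⟨by linarith [hr.1], by linarith [hr.2]⟩

theorem mono (h : IsRiemannSum A g δ a b X) (hδ : ∀ t, δ t ≤ δ' t) :
    IsRiemannSum A g δ' a b X := by
  induction h with
  | refl => exact refl
  | snoc _ hbc ht hfine ih =>
    exact ih.snoc hbc ht <| hfine.trans <|
      Ioo_subset_Ioo (sub_le_sub_left (hδ _) _) (by gcongr; exact hδ _)

theorem append (h : IsRiemannSum A g δ a b X) (h' : IsRiemannSum A g δ b c Y) :
    IsRiemannSum A g δ a c (X + Y) := by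
  induction h' with
  | refl => simpa only [add_zero] using h
  | snoc _ hbc ht hδ ih => simpa only [add_assoc] using ih.snoc hbc ht hδ

theorem translate (hA : ∀ s t, A (t + ω) - A (s + ω) = A t - A s)
    (h : IsRiemannSum A (fun t => g (t + ω)) (fun t => δ (t + ω)) a b X) :
    IsRiemannSum A g δ (a + ω) (b + ω) X := by
  induction h with
  | refl => exact refl
  | @snoc b c t X _ hbc ht hδ ih =>
    rw [← hA]
    refine ih.snoc (by gcongr) ⟨by gcongr; exact ht.1, by gcongr; exact ht.2⟩ ?_
    rw [← image_add_const_Icc, image_subset_iff]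
    intro r hr
    obtain ⟨h₁, h₂⟩ := hδ hr
    constructor <;> linarith

theorem exists_isTaggedPartition (h : IsRiemannSum A g δ a b X) :
    ∃ (ν : ℕ) (α τ : ℕ → ℝ), IsTaggedPartition a b ν α τ ∧ IsFine δ ν α τ ∧
      ∑ j ∈ Finset.range ν, (A (α (j + 1)) - A (α j)) (g (τ j)) = X := by
  induction h with
  | refl => exact ⟨0, fun _ => a, fun _ => a, ⟨rfl, rfl, by simp⟩, by simp [IsFine], by simp⟩
  | @snoc b c t X _ hbc ht hδ ih =>
    obtain ⟨ν, α, τ, ⟨hα₀, rfl, hα⟩, hfine, rfl⟩ := ih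
    let α' := Function.update α (ν + 1) c
    let τ' := Function.update τ ν t
    have old : ∀ j < ν, α' j = α j ∧ α' (j + 1) = α (j + 1) ∧ τ' j = τ j := fun j hj => by
      grind [Function.update_of_ne]
    have new : α' ν = α ν ∧ α' (ν + 1) = c ∧ τ' ν = t := by
      grind [Function.update_of_ne, Function.update_self]
    refine ⟨ν + 1, α', τ', ⟨by grind [Function.update_of_ne], new.2.1, ?_⟩, ?_, ?_⟩
    · rintro j hj
      rcases Nat.lt_succ_iff_lt_or_eq.1 hj with hj | rfl
      · simpa only [old j hj] using hα j hj
      · simpa only [new] using ⟨hbc, ht⟩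
    · rintro j hj
      rcases Nat.lt_succ_iff_lt_or_eq.1 hj with hj | rfl
      · simpa only [old j hj] using hfine j hj
      · simpa only [new] using hδ
    · rw [Finset.sum_range_succ, new.1, new.2.1, new.2.2]
      congr 1
      refine Finset.sum_congr rfl fun j hj => ?_
      obtain ⟨h₁, h₂, h₃⟩ := old j (Finset.mem_range.1 hj)
      rw [h₁, h₂, h₃]

end IsRiemannSum

theorem IsTaggedPartition.isRiemannSum {ν : ℕ} {α τ : ℕ → ℝ} (h : IsTaggedPartition a b ν α τ)
    (hδ : IsFine δ ν α τ) :
    IsRiemannSum A g δ a b (∑ j ∈ Finset.range ν, (A (α (j + 1)) - A (α j)) (g (τ j))) := by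
  obtain ⟨rfl, rfl, hα⟩ := h
  induction ν with
  | zero => simpa using IsRiemannSum.refl
  | succ ν ih =>
    rw [Finset.sum_range_succ]
    exact (ih (fun j hj => hδ j (hj.trans ν.lt_succ_self))
      fun j hj => hα j (hj.trans ν.lt_succ_self)).snoc (hα ν ν.lt_succ_self).1
        (hα ν ν.lt_succ_self).2 (hδ ν ν.lt_succ_self)

theorem hasKSIntegralOn_iff : HasKSIntegralOn A g a b X ↔
    ∀ ε > 0, ∃ δ : ℝ → ℝ, (∀ t ∈ Icc a b, 0 < δ t) ∧
      ∀ Y, IsRiemannSum A g δ a b Y → ‖Y - X‖ < ε := by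
  refine forall₂_congr fun ε _ => exists_congr fun δ => and_congr_right fun _ => ⟨?_, ?_⟩
  · rintro h Y hY
    obtain ⟨ν, α, τ, hα, hδ, rfl⟩ := hY.exists_isTaggedPartition
    exact h ν α τ hα hδ
  · exact fun h ν α τ hα hδ => h _ (hα.isRiemannSum hδ)

theorem exists_isRiemannSum (A : ℝ → E →L[ℝ] E) (g : ℝ → E) (hab : a ≤ b)
    (hδ : ∀ t ∈ Icc a b, 0 < δ t) : ∃ X, IsRiemannSum A g δ a b X := by
  rcases hab.eq_or_lt with rfl | hab
  · exact ⟨0, .refl⟩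
  refine cousin_induction (Q := fun u v => ∃ X, IsRiemannSum A g δ u v X) hab ?_ ?_ ?_
  · rintro u v w - - - - ⟨X, hX⟩ ⟨Y, hY⟩
    exact ⟨_, hX.append hY⟩
  · intro t ht
    filter_upwards [Ioo_mem_nhdsGT (lt_add_of_pos_right t (hδ t ⟨ht.1, ht.2.le⟩))] with v hv
    exact ⟨_, IsRiemannSum.single_left hv.1 hv.2⟩
  · intro t ht
    filter_upwards [Ioo_mem_nhdsLT (sub_lt_self t (hδ t ⟨ht.1.le, ht.2⟩))] with v hv
    exact ⟨_, IsRiemannSum.single_right hv.2 hv.1⟩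

theorem exists_isRiemannSum_of_two_gauges (A : ℝ → E →L[ℝ] E) (g : ℝ → E) (hab : a ≤ b)
    (hδ : ∀ t ∈ Icc a b, 0 < δ t) (hδ' : ∀ t ∈ Icc a b, 0 < δ' t) :
    ∃ X, IsRiemannSum A g δ a b X ∧ IsRiemannSum A g δ' a b X := by
  obtain ⟨X, hX⟩ := exists_isRiemannSum (δ := fun t => min (δ t) (δ' t)) A g hab
    fun t ht => lt_min (hδ t ht) (hδ' t ht)
  exact ⟨X, hX.mono fun _ => min_le_left _ _, hX.mono fun _ => min_le_right _ _⟩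

theorem HasKSIntegralOn.unique (hab : a ≤ b) (h : HasKSIntegralOn A g a b X)
    (h' : HasKSIntegralOn A g a b Y) : X = Y := by
  rw [hasKSIntegralOn_iff] at h h'
  refine eq_of_forall_dist_le fun ε hε => ?_
  obtain ⟨δ, hδ, hX⟩ := h (ε / 2) (half_pos hε)
  obtain ⟨δ', hδ', hY⟩ := h' (ε / 2) (half_pos hε)
  obtain ⟨Z, hZ, hZ'⟩ := exists_isRiemannSum_of_two_gauges A g hab hδ hδ'
  calc dist X Y ≤ dist Z X + dist Z Y := dist_triangle_left X Y Z
    _ ≤ ε := by rw [dist_eq_norm, dist_eq_norm]; linarith [hX Z hZ, hY Z hZ']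

theorem HasKSIntegral.unique (h : HasKSIntegral A g a b X) (h' : HasKSIntegral A g a b Y) :
    X = Y := by
  rcases le_total a b with hab | hba
  · exact (h.1 hab).unique hab (h'.1 hab)
  · exact neg_injective ((h.2 hba).unique hba (h'.2 hba))

theorem HasKSIntegralOn.translate (hA : ∀ s t, A (t + ω) - A (s + ω) = A t - A s)
    (h : HasKSIntegralOn A g (a + ω) (b + ω) X) :
    HasKSIntegralOn A (fun t => g (t + ω)) a b X := by
  rw [hasKSIntegralOn_iff] at h ⊢
  intro ε hε
  obtain ⟨δ, hδ, H⟩ := h ε hε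
  exact ⟨fun t => δ (t + ω), fun t ht => hδ _ ⟨by linarith [ht.1], by linarith [ht.2]⟩,
    fun Y hY => H Y (hY.translate hA)⟩

theorem HasKSIntegral.translate (hA : ∀ s t, A (t + ω) - A (s + ω) = A t - A s)
    (h : HasKSIntegral A g (a + ω) (b + ω) X) : HasKSIntegral A (fun t => g (t + ω)) a b X :=
  ⟨fun hab => (h.1 (by gcongr)).translate hA, fun hba => (h.2 (by gcongr)).translate hA⟩

theorem HasKSIntegralOn.sub_left (hab : a ≤ b) (hbc : b ≤ c) (hX : HasKSIntegralOn A g a b X)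
    (hY : HasKSIntegralOn A g a c Y) : HasKSIntegralOn A g b c (Y - X) := by
  rw [hasKSIntegralOn_iff] at hX hY ⊢
  intro ε hε
  obtain ⟨δ, hδ, hX⟩ := hX (ε / 2) (half_pos hε)
  obtain ⟨δ', hδ', hY⟩ := hY (ε / 2) (half_pos hε)
  obtain ⟨Z, hZ, hZ'⟩ := exists_isRiemannSum_of_two_gauges A g hab hδ
    fun t ht => hδ' t ⟨ht.1, ht.2.trans hbc⟩
  refine ⟨δ', fun t ht => hδ' t ⟨hab.trans ht.1, ht.2⟩, fun W hW => ?_⟩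
  calc ‖W - (Y - X)‖ = ‖Z + W - Y - (Z - X)‖ := by congr 1; abel
    _ ≤ ‖Z + W - Y‖ + ‖Z - X‖ := norm_sub_le _ _
    _ < ε := by linarith [hX Z hZ, hY _ (hZ'.append hW)]

theorem HasKSIntegralOn.sub_right (hab : a ≤ b) (hbc : b ≤ c) (hX : HasKSIntegralOn A g b c X)
    (hY : HasKSIntegralOn A g a c Y) : HasKSIntegralOn A g a b (Y - X) := by
  rw [hasKSIntegralOn_iff] at hX hY ⊢
  intro ε hε
  obtain ⟨δ, hδ, hX⟩ := hX (ε / 2) (half_pos hε)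
  obtain ⟨δ', hδ', hY⟩ := hY (ε / 2) (half_pos hε)
  obtain ⟨Z, hZ, hZ'⟩ := exists_isRiemannSum_of_two_gauges A g hbc hδ
    fun t ht => hδ' t ⟨hab.trans ht.1, ht.2⟩
  refine ⟨δ', fun t ht => hδ' t ⟨ht.1, ht.2.trans hbc⟩, fun W hW => ?_⟩
  calc ‖W - (Y - X)‖ = ‖W + Z - Y - (Z - X)‖ := by congr 1; abel
    _ ≤ ‖W + Z - Y‖ + ‖Z - X‖ := norm_sub_le _ _
    _ < ε := by linarith [hX Z hZ, hY _ (hW.append hZ')]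

theorem HasKSIntegral.eq_zero_of_self (h : HasKSIntegral A g a a X) : X = 0 :=
  have hX := h.1 le_rfl
  hX.unique le_rfl <| by simpa only [sub_self] using hX.sub_left le_rfl le_rfl hX

end KurzweilStieltjes

section Residual

variable {E G : Type*} [NormedAddCommGroup E] [NormedSpace ℝ E] [NormedAddCommGroup G]
  [NormedSpace ℝ G]

/-- The defect `F v - F τ - (A v - A τ) (g τ)` of the one-term integral sum tagged at `τ`, as an
approximation to the increment of a candidate `F` for the indefinite integral `∫ d[A] g`. -/
def residual (A : ℝ → E →L[ℝ] G) (g : ℝ → E) (F : ℝ → G) (τ v : ℝ) : G :=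
  F v - F τ - (A v - A τ) (g τ)

variable {A : ℝ → E →L[ℝ] E} {g F : ℝ → E} {a b s τ : ℝ}

theorem tendsto_residual_nhdsLT (haτ : a < τ)
    (h : ∀ v ∈ Icc a τ, HasKSIntegralOn A g a v (F v - F a)) :
    Tendsto (residual A g F τ) (𝓝[<] τ) (𝓝 0) := by
  refine NormedAddGroup.tendsto_nhds_zero.2 fun ε hε => ?_
  obtain ⟨δ, hδ, hτ⟩ := hasKSIntegralOn_iff.1 (h τ ⟨haτ.le, le_rfl⟩) (ε / 2) (half_pos hε)
  filter_upwards [Ioo_mem_nhdsLT haτ, Ioo_mem_nhdsLT (sub_lt_self τ (hδ τ ⟨haτ.le, le_rfl⟩))]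
    with v hav hδv
  obtain ⟨δ', hδ', hv⟩ := hasKSIntegralOn_iff.1 (h v ⟨hav.1.le, hav.2.le⟩) (ε / 2) (half_pos hε)
  obtain ⟨Z, hZ, hZ'⟩ := exists_isRiemannSum_of_two_gauges A g hav.1.le
    (fun t ht => hδ t ⟨ht.1, ht.2.trans hav.2.le⟩) hδ'
  calc ‖residual A g F τ v‖
      = ‖Z + (A τ - A v) (g τ) - (F τ - F a) - (Z - (F v - F a))‖ := by
        simp only [residual, _root_.sub_apply]; congr 1; abel
    _ ≤ ‖Z + (A τ - A v) (g τ) - (F τ - F a)‖ + ‖Z - (F v - F a)‖ := norm_sub_le _ _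
    _ < ε := by linarith [hv Z hZ', hτ _ (hZ.append (.single_right hav.2 hδv.1))]

theorem tendsto_residual_nhdsGT (hτb : τ < b)
    (h : ∀ v ∈ Icc τ b, HasKSIntegralOn A g v b (F b - F v)) :
    Tendsto (residual A g F τ) (𝓝[>] τ) (𝓝 0) := by
  refine NormedAddGroup.tendsto_nhds_zero.2 fun ε hε => ?_
  obtain ⟨δ, hδ, hτ⟩ := hasKSIntegralOn_iff.1 (h τ ⟨le_rfl, hτb.le⟩) (ε / 2) (half_pos hε)
  filter_upwards [Ioo_mem_nhdsGT hτb,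
    Ioo_mem_nhdsGT (lt_add_of_pos_right τ (hδ τ ⟨le_rfl, hτb.le⟩))] with v hvb hδv
  obtain ⟨δ', hδ', hv⟩ := hasKSIntegralOn_iff.1 (h v ⟨hvb.1.le, hvb.2.le⟩) (ε / 2) (half_pos hε)
  obtain ⟨Z, hZ, hZ'⟩ := exists_isRiemannSum_of_two_gauges A g hvb.2.le
    (fun t ht => hδ t ⟨hvb.1.le.trans ht.1, ht.2⟩) hδ'
  rw [← norm_neg]
  calc ‖-residual A g F τ v‖
      = ‖(A v - A τ) (g τ) + Z - (F b - F τ) - (Z - (F b - F v))‖ := by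
        simp only [residual]; congr 1; abel
    _ ≤ ‖(A v - A τ) (g τ) + Z - (F b - F τ)‖ + ‖Z - (F b - F v)‖ := norm_sub_le _ _
    _ < ε := by
      linarith [hv Z hZ', hτ _ (.append (.single_left hvb.1 hδv.2) hZ)]

theorem tendsto_residual_of_hasKSIntegral (h : ∀ t, HasKSIntegral A g s t (F t - F s)) (τ : ℝ) :
    Tendsto (residual A g F τ) (𝓝[<] τ) (𝓝 0) ∧ Tendsto (residual A g F τ) (𝓝[>] τ) (𝓝 0) := by
  have right_of_base : ∀ t, s ≤ t → HasKSIntegralOn A g s t (F t - F s) := fun t hst => (h t).1 hst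
  have left_of_base : ∀ t, t ≤ s → HasKSIntegralOn A g t s (F s - F t) := fun t hts => by
    simpa only [neg_sub] using (h t).2 hts
  constructor
  · rcases lt_or_ge s τ with hsτ | hτs
    · exact tendsto_residual_nhdsLT hsτ fun v hv => right_of_base v hv.1
    · refine tendsto_residual_nhdsLT (sub_one_lt τ) fun v hv => ?_
      have hvs : v ≤ s := hv.2.trans hτs
      simpa only [sub_sub_sub_cancel_left] using
        (left_of_base v hvs).sub_right hv.1 hvs (left_of_base (τ - 1) (hv.1.trans hvs))
  · rcases lt_or_ge τ s with hτs | hsτ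
    · exact tendsto_residual_nhdsGT hτs fun v hv => left_of_base v hv.2
    · refine tendsto_residual_nhdsGT (lt_add_one τ) fun v hv => ?_
      have hsv : s ≤ v := hsτ.trans hv.1
      simpa only [sub_sub_sub_cancel_right] using
        (right_of_base v hsv).sub_left hsv hv.2 (right_of_base (τ + 1) (hsv.trans hv.2))

end Residual

section Primitive

variable {E G G' : Type*} [NormedAddCommGroup E] [NormedSpace ℝ E] [NormedAddCommGroup G]
  [NormedSpace ℝ G] [NormedAddCommGroup G'] [NormedSpace ℝ G']

/-- `F` is a primitive on `S` of `d[A] g` up to an error `ε` per unit of growth of `M`. -/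
def IsApproxPrimitive (ε : ℝ) (M : ℝ → ℝ) (A : ℝ → E →L[ℝ] G) (g : ℝ → E) (F : ℝ → G)
    (S : Set ℝ) : Prop :=
  ∀ τ ∈ S, IsBigOWith ε (𝓝[S] τ) (residual A g F τ) fun v => M v - M τ

/-- `F` is an indefinite integral of `d[A] g` on `S`, in the differential form that the residual
at each point is negligible with respect to the increments of `M`. For monotone `M` this implies
that the Kurzweil–Stieltjes integral exists and equals the increment of `F`. -/
def IsPrimitive (M : ℝ → ℝ) (A : ℝ → E →L[ℝ] G) (g : ℝ → E) (F : ℝ → G) (S : Set ℝ) : Prop :=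
  ∀ τ ∈ S, residual A g F τ =o[𝓝[S] τ] fun v => M v - M τ

variable {M : ℝ → ℝ} {A : ℝ → E →L[ℝ] G} {g g' : ℝ → E} {F F' : ℝ → G} {S T : Set ℝ}
  {a b s t v ε ε' : ℝ}

theorem isPrimitive_iff_forall_isApproxPrimitive :
    IsPrimitive M A g F S ↔ ∀ ε > 0, IsApproxPrimitive ε M A g F S :=
  ⟨fun h _ hε τ hτ => (h τ hτ).forall_isBigOWith hε,
    fun h τ hτ => IsLittleO.of_isBigOWith fun _ hε => h _ hε τ hτ⟩

theorem residual_add (τ v : ℝ) :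
    residual A (g + g') (F + F') τ v = residual A g F τ v + residual A g' F' τ v := by
  simp only [residual, Pi.add_apply, map_add]; abel

theorem residual_sub (τ v : ℝ) :
    residual A (g - g') (F - F') τ v = residual A g F τ v - residual A g' F' τ v := by
  simp only [residual, Pi.sub_apply, map_sub]; abel

theorem residual_add_const (c : G) (τ v : ℝ) :
    residual A g (fun t => F t + c) τ v = residual A g F τ v := by
  simp only [residual, add_sub_add_right_eq_sub]

theorem eqOn_piecewise_Iic_left {X : Type*} (k k' : ℝ → X) :
    EqOn k ((Iic v).piecewise k k') (Icc a v) :=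
  ((piecewise_eqOn (Iic v) k k').mono fun _ ht => ht.2).symm

theorem eqOn_piecewise_Iic_right {X : Type*} {k k' : ℝ → X} (hk : k v = k' v) :
    EqOn k' ((Iic v).piecewise k k') (Icc v b) := fun t ht => by
  rcases ht.1.eq_or_lt with rfl | hvt
  · rw [piecewise_eqOn (Iic v) k k' self_mem_Iic, hk]
  · exact (piecewise_eqOn_compl (Iic v) k k' (notMem_Iic.2 hvt)).symm

namespace IsApproxPrimitive

theorem congr (h : IsApproxPrimitive ε M A g F S) (hg : EqOn g g' S) (hF : EqOn F F' S) :
    IsApproxPrimitive ε M A g' F' S := fun τ hτ =>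
  (h τ hτ).congr' rfl (eventually_mem_nhdsWithin.mono fun v hv => by
    simp only [residual, hg hτ, hF hτ, hF hv]) .rfl

theorem sub (h : IsApproxPrimitive ε M A g F S) (h' : IsApproxPrimitive ε' M A g' F' S) :
    IsApproxPrimitive (ε + ε') M A (g - g') (F - F') S := fun τ hτ =>
  ((h τ hτ).sub (h' τ hτ)).congr_left fun v => (residual_sub τ v).symm

theorem add_const (h : IsApproxPrimitive ε M A g F S) (c : G) :
    IsApproxPrimitive ε M A g (fun t => F t + c) S := fun τ hτ =>
  (h τ hτ).congr_left fun v => (residual_add_const c τ v).symm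

theorem reflect (h : IsApproxPrimitive ε M A g F (Icc a b)) :
    IsApproxPrimitive ε (fun t => -M (-t)) (fun t => A (-t)) (fun t => g (-t)) (fun t => F (-t))
      (Icc (-b) (-a)) := by
  intro τ hτ
  have maps : MapsTo Neg.neg (Icc (-b) (-a)) (Icc a b) := fun t ht =>
    ⟨le_neg_of_le_neg ht.2, neg_le_of_neg_le ht.1⟩
  have lim : Tendsto Neg.neg (𝓝[Icc (-b) (-a)] τ) (𝓝[Icc a b] (-τ)) :=
    continuous_neg.continuousWithinAt.tendsto_nhdsWithin maps
  refine ((h (-τ) (maps hτ)).comp_tendsto lim).neg_right.congr_right fun v => ?_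
  simp only [Function.comp_apply]; ring

theorem union (hS : IsClosed S) (hT : IsClosed T) (h : IsApproxPrimitive ε M A g F S)
    (h' : IsApproxPrimitive ε M A g F T) : IsApproxPrimitive ε M A g F (S ∪ T) := by
  have near {R : Set ℝ} (hR : IsClosed R) (hF : IsApproxPrimitive ε M A g F R) (τ : ℝ) :
      IsBigOWith ε (𝓝[R] τ) (residual A g F τ) fun v => M v - M τ := by
    by_cases hτ : τ ∈ R
    · exact hF τ hτ
    · rw [notMem_closure_iff_nhdsWithin_eq_bot.1 (hR.closure_eq.symm ▸ hτ)]
      exact isBigOWith_bot _ _ _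
  intro τ _
  rw [nhdsWithin_union, isBigOWith_iff, eventually_sup]
  exact ⟨(near hS h τ).bound, (near hT h' τ).bound⟩

theorem piecewise (h : IsApproxPrimitive ε M A g F (Icc a v))
    (h' : IsApproxPrimitive ε M A g' F' (Icc v b)) (hav : a ≤ v) (hvb : v ≤ b)
    (hg : g v = g' v) (hF : F v = F' v) :
    IsApproxPrimitive ε M A ((Iic v).piecewise g g') ((Iic v).piecewise F F') (Icc a b) := by
  rw [← Icc_union_Icc_eq_Icc hav hvb]
  exact (h.congr (eqOn_piecewise_Iic_left g g') (eqOn_piecewise_Iic_left F F')).union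
    isClosed_Icc isClosed_Icc
    (h'.congr (eqOn_piecewise_Iic_right hg) (eqOn_piecewise_Iic_right hF))

end IsApproxPrimitive

namespace IsPrimitive

theorem isApproxPrimitive (h : IsPrimitive M A g F S) (hε : 0 < ε) :
    IsApproxPrimitive ε M A g F S :=
  isPrimitive_iff_forall_isApproxPrimitive.1 h ε hε

theorem mono_set (h : IsPrimitive M A g F S) (hT : T ⊆ S) : IsPrimitive M A g F T :=
  fun τ hτ => (h τ (hT hτ)).mono (nhdsWithin_mono τ hT)

theorem congr (h : IsPrimitive M A g F S) (hg : EqOn g g' S) (hF : EqOn F F' S) :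
    IsPrimitive M A g' F' S :=
  isPrimitive_iff_forall_isApproxPrimitive.2 fun _ hε => (h.isApproxPrimitive hε).congr hg hF

theorem add (h : IsPrimitive M A g F S) (h' : IsPrimitive M A g' F' S) :
    IsPrimitive M A (g + g') (F + F') S := fun τ hτ =>
  ((h τ hτ).add (h' τ hτ)).congr_left fun v => (residual_add τ v).symm

theorem sub (h : IsPrimitive M A g F S) (h' : IsPrimitive M A g' F' S) :
    IsPrimitive M A (g - g') (F - F') S := fun τ hτ =>
  ((h τ hτ).sub (h' τ hτ)).congr_left fun v => (residual_sub τ v).symm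

theorem add_const (h : IsPrimitive M A g F S) (c : G) :
    IsPrimitive M A g (fun t => F t + c) S := fun τ hτ =>
  (h τ hτ).congr_left fun v => (residual_add_const c τ v).symm

theorem reflect (h : IsPrimitive M A g F (Icc a b)) :
    IsPrimitive (fun t => -M (-t)) (fun t => A (-t)) (fun t => g (-t)) (fun t => F (-t))
      (Icc (-b) (-a)) :=
  isPrimitive_iff_forall_isApproxPrimitive.2 fun _ hε => (h.isApproxPrimitive hε).reflect

theorem piecewise (h : IsPrimitive M A g F (Icc a v)) (h' : IsPrimitive M A g' F' (Icc v b))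
    (hav : a ≤ v) (hvb : v ≤ b) (hg : g v = g' v) (hF : F v = F' v) :
    IsPrimitive M A ((Iic v).piecewise g g') ((Iic v).piecewise F F') (Icc a b) :=
  isPrimitive_iff_forall_isApproxPrimitive.2 fun _ hε =>
    (h.isApproxPrimitive hε).piecewise (h'.isApproxPrimitive hε) hav hvb hg hF

theorem univ_of_forall_Icc (h : ∀ a b, IsPrimitive M A g F (Icc a b)) :
    IsPrimitive M A g F univ := fun τ _ => by
  have hτ : Icc (τ - 1) (τ + 1) ∈ 𝓝 τ := Icc_mem_nhds (sub_one_lt τ) (lt_add_one τ)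
  rw [nhdsWithin_univ, ← nhdsWithin_eq_nhds.2 hτ]
  exact h (τ - 1) (τ + 1) τ (mem_of_mem_nhds hτ)

theorem map {E' : Type*} [NormedAddCommGroup E'] [NormedSpace ℝ E'] {A' : ℝ → E' →L[ℝ] G'}
    {g' : ℝ → E'} {F' : ℝ → G'} (h : IsPrimitive M A g F S) (φ : G →L[ℝ] G')
    (hφ : ∀ τ v, residual A' g' F' τ v = φ (residual A g F τ v)) :
    IsPrimitive M A' g' F' S := fun τ hτ =>
  ((φ.isBigO_comp _ _).trans_isLittleO (h τ hτ)).congr_left fun v => (hφ τ v).symm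

end IsPrimitive

theorem nhdsGT_le_nhdsWithin_Icc (ht : t ∈ Ico a b) : 𝓝[>] t ≤ 𝓝[Icc a b] t :=
  le_inf inf_le_left <| le_principal_iff.2 <|
    mem_of_superset (Ioc_mem_nhdsGT ht.2) fun _ hs => ⟨ht.1.trans hs.1.le, hs.2⟩

theorem nhdsLT_le_nhdsWithin_Icc (ht : t ∈ Ioc a b) : 𝓝[<] t ≤ 𝓝[Icc a b] t :=
  le_inf inf_le_left <| le_principal_iff.2 <|
    mem_of_superset (Ico_mem_nhdsLT ht.1) fun _ hs => ⟨hs.1, hs.2.le.trans ht.2⟩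

theorem norm_sub_le_of_eventually {X : Type*} [NormedAddCommGroup X] {k : ℝ → X} {K : ℝ}
    (hM : Monotone M)
    (h : ∀ τ ∈ Icc a b, ∀ᶠ v in 𝓝[Icc a b] τ, ‖k v - k τ‖ ≤ K * |M v - M τ|)
    (hs : s ∈ Icc a b) (ht : t ∈ Icc a b) : ‖k t - k s‖ ≤ K * |M t - M s| := by
  wlog hst : s ≤ t generalizing s t
  · rw [norm_sub_rev, abs_sub_comm]
    exact this ht hs (le_of_not_ge hst)
  rcases hst.eq_or_lt with rfl | hst
  · simp
  refine cousin_induction (Q := fun u v => ‖k v - k u‖ ≤ K * |M v - M u|) hst ?_ ?_ ?_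
  · intro u v w _ huv hvw _ hleft hright
    calc ‖k w - k u‖ ≤ ‖k w - k v‖ + ‖k v - k u‖ := norm_sub_le_norm_sub_add_norm_sub ..
      _ ≤ K * |M w - M v| + K * |M v - M u| := add_le_add hright hleft
      _ = K * |M w - M u| := by
        rw [abs_of_nonneg (sub_nonneg.2 (hM hvw.le)), abs_of_nonneg (sub_nonneg.2 (hM huv.le)),
          abs_of_nonneg (sub_nonneg.2 (hM (huv.trans hvw).le))]
        ring
  · intro τ hτ
    exact (h τ ⟨hs.1.trans hτ.1, hτ.2.le.trans ht.2⟩).filter_mono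
      (nhdsGT_le_nhdsWithin_Icc ⟨hs.1.trans hτ.1, hτ.2.trans_le ht.2⟩)
  · intro τ hτ
    filter_upwards [(h τ ⟨hs.1.trans hτ.1.le, hτ.2.trans ht.2⟩).filter_mono
      (nhdsLT_le_nhdsWithin_Icc ⟨hs.1.trans_lt hτ.1, hτ.2.trans ht.2⟩)] with u hu
    rwa [norm_sub_rev, abs_sub_comm]

theorem IsApproxPrimitive.norm_sub_sub_le (hM : Monotone M)
    (h : IsApproxPrimitive ε M A g F (Icc a b)) (h' : IsApproxPrimitive ε' M A g F' (Icc a b))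
    (hs : s ∈ Icc a b) (ht : t ∈ Icc a b) :
    ‖F t - F' t - (F s - F' s)‖ ≤ (ε + ε') * |M t - M s| := by
  refine norm_sub_le_of_eventually (k := F - F') hM (fun τ hτ => ?_) hs ht
  simpa [residual] using (h.sub h' τ hτ).bound

/-- `M` is monotone and its increments dominate those of `k`. -/
structure IsMajorant {X : Type*} [NormedAddCommGroup X] (M : ℝ → ℝ) (k : ℝ → X) : Prop where
  monotone : Monotone M
  norm_sub_le : ∀ s t, ‖k t - k s‖ ≤ |M t - M s|

theorem IsMajorant.reflect {X : Type*} [NormedAddCommGroup X] {k : ℝ → X} (h : IsMajorant M k) :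
    IsMajorant (fun t => -M (-t)) (fun t => k (-t)) where
  monotone _ _ hst := neg_le_neg (h.monotone (neg_le_neg hst))
  norm_sub_le s t := by
    rw [neg_sub_neg, abs_sub_comm]
    exact h.norm_sub_le (-s) (-t)

theorem IsPrimitive.norm_sub_le (hA : IsMajorant M A) (h : IsPrimitive M A g F (Icc a b)) {D : ℝ}
    (hg : ∀ t ∈ Icc a b, ‖g t‖ ≤ D) (hs : s ∈ Icc a b) (ht : t ∈ Icc a b) :
    ‖F t - F s‖ ≤ D * |M t - M s| := by
  have approx : ∀ ε > 0, ‖F t - F s‖ ≤ (D + ε) * |M t - M s| := fun ε hε => by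
    refine norm_sub_le_of_eventually hA.monotone (fun τ hτ => ?_) hs ht
    filter_upwards [(h.isApproxPrimitive hε τ hτ).bound] with v hv
    calc ‖F v - F τ‖ = ‖(A v - A τ) (g τ) + residual A g F τ v‖ := by
          rw [residual, add_sub_cancel]
      _ ≤ ‖A v - A τ‖ * ‖g τ‖ + ε * |M v - M τ| :=
        norm_add_le_of_le (ContinuousLinearMap.le_opNorm _ _) hv
      _ ≤ |M v - M τ| * D + ε * |M v - M τ| := by
        gcongr
        exacts [hA.norm_sub_le τ v, hg τ hτ]
      _ = (D + ε) * |M v - M τ| := by ring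
  have lim : Tendsto (fun ε : ℝ => (D + ε) * |M t - M s|) (𝓝[>] 0) (𝓝 ((D + 0) * |M t - M s|)) :=
    ((continuous_const.add continuous_id).mul continuous_const).continuousWithinAt
  rw [add_zero] at lim
  exact ge_of_tendsto lim (eventually_mem_nhdsWithin.mono approx)

end Primitive

section Integral

variable {E : Type*} [NormedAddCommGroup E] [NormedSpace ℝ E] {M : ℝ → ℝ} {A : ℝ → E →L[ℝ] E}
  {g F : ℝ → E} {δ : ℝ → ℝ} {S : Set ℝ} {a b c s t ε : ℝ} {X : E}

theorem IsRiemannSum.norm_sub_le (hM : Monotone M)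
    (hδ : ∀ τ ∈ Icc a b, ∀ v ∈ Icc a b, |v - τ| < δ τ →
      ‖residual A g F τ v‖ ≤ ε * |M v - M τ|)
    (h : IsRiemannSum A g δ a c X) (hcb : c ≤ b) :
    ‖X - (F c - F a)‖ ≤ ε * (M c - M a) := by
  induction h with
  | refl => simp
  | @snoc u w τ X h huw hτ hfine ih =>
    have hau := h.le
    have hτab : τ ∈ Icc a b := ⟨hau.trans hτ.1, hτ.2.trans hcb⟩
    have bound : ∀ v ∈ Icc u w, ‖residual A g F τ v‖ ≤ ε * |M v - M τ| := fun v hv =>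
      hδ τ hτab v ⟨hau.trans hv.1, hv.2.trans hcb⟩
        (abs_sub_lt_iff.2 ⟨by linarith [(hfine hv).2], by linarith [(hfine hv).1]⟩)
    calc ‖X + (A w - A u) (g τ) - (F w - F a)‖
        = ‖X - (F u - F a) + residual A g F τ u - residual A g F τ w‖ := by
          simp only [residual, _root_.sub_apply]; congr 1; abel
      _ ≤ ε * (M u - M a) + ε * |M u - M τ| + ε * |M w - M τ| :=
        norm_sub_le_of_le (norm_add_le_of_le (ih (huw.le.trans hcb))
          (bound u (left_mem_Icc.2 huw.le))) (bound w (right_mem_Icc.2 huw.le))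
      _ = ε * (M w - M a) := by
        rw [abs_sub_comm, abs_of_nonneg (sub_nonneg.2 (hM hτ.1)),
          abs_of_nonneg (sub_nonneg.2 (hM hτ.2))]
        ring

theorem IsPrimitive.hasKSIntegralOn (hM : Monotone M) (h : IsPrimitive M A g F (Icc a b)) :
    HasKSIntegralOn A g a b (F b - F a) := by
  rw [hasKSIntegralOn_iff]
  intro ε hε
  let η := ε / (|M b - M a| + 1)
  have hη : 0 < η := by positivity
  have gauge : ∀ τ, ∃ δ > 0, τ ∈ Icc a b → ∀ v ∈ Icc a b, |v - τ| < δ →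
      ‖residual A g F τ v‖ ≤ η * |M v - M τ| := fun τ => by
    by_cases hτ : τ ∈ Icc a b
    · obtain ⟨δ, hδ, H⟩ := Metric.mem_nhdsWithin_iff.1 (h.isApproxPrimitive hη τ hτ).bound
      exact ⟨δ, hδ, fun _ v hv hvτ => H ⟨hvτ, hv⟩⟩
    · exact ⟨1, one_pos, fun h => absurd h hτ⟩
  choose δ hδ H using gauge
  refine ⟨δ, fun t _ => hδ t, fun Y hY => ?_⟩
  calc ‖Y - (F b - F a)‖ ≤ η * (M b - M a) := hY.norm_sub_le hM H le_rfl
    _ ≤ η * |M b - M a| := by gcongr; exact le_abs_self _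
    _ < η * (|M b - M a| + 1) := by gcongr; exact lt_add_one _
    _ = ε := div_mul_cancel₀ ε (by positivity)

theorem IsPrimitive.hasKSIntegral (hM : Monotone M) (h : IsPrimitive M A g F S)
    (hS : S.OrdConnected) (hs : s ∈ S) (ht : t ∈ S) : HasKSIntegral A g s t (F t - F s) := by
  refine ⟨fun _ => (h.mono_set (hS.out hs ht)).hasKSIntegralOn hM, fun _ => ?_⟩
  rw [neg_sub]
  exact (h.mono_set (hS.out ht hs)).hasKSIntegralOn hM

end Integral

section Regularity

variable {X : Type*} [NormedAddCommGroup X] {M : ℝ → ℝ} {k k' : ℝ → X} {l l' : Filter ℝ}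
  {S : Set ℝ} {a b m τ : ℝ}

/-- `k` has a limit along the filter `l` of points near `τ`, and this limit is `k τ` unless `M`
jumps at `τ` along `l`. -/
def IsRegularAlong {X : Type*} [TopologicalSpace X] (M : ℝ → ℝ) (l : Filter ℝ) (τ : ℝ)
    (k : ℝ → X) : Prop :=
  (∃ y, Tendsto k l (𝓝 y)) ∧ (Tendsto M l (𝓝 (M τ)) → Tendsto k l (𝓝 (k τ)))

/-- The restriction of `k` to `S` has one-sided limits, and it jumps only where `M` does. -/
def IsRegularOn {X : Type*} [TopologicalSpace X] (M : ℝ → ℝ) (S : Set ℝ) (k : ℝ → X) : Prop :=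
  ∀ τ ∈ S, IsRegularAlong M (𝓝[S ∩ Iio τ] τ) τ k ∧ IsRegularAlong M (𝓝[S ∩ Ioi τ] τ) τ k

theorem nhdsWithin_le_pure_sup_sup (S : Set ℝ) (τ : ℝ) :
    𝓝[S] τ ≤ pure τ ⊔ (𝓝[S ∩ Iio τ] τ ⊔ 𝓝[S ∩ Ioi τ] τ) := by
  rw [← nhdsWithin_union, ← inter_union_distrib_left, Iio_union_Ioi, ← nhdsWithin_insert]
  exact nhdsWithin_mono τ fun t ht => (eq_or_ne t τ).imp id fun hne => ⟨ht, hne⟩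

namespace IsRegularAlong

theorem bot (k : ℝ → X) : IsRegularAlong M ⊥ τ k :=
  ⟨⟨k τ, tendsto_bot⟩, fun _ => tendsto_bot⟩

theorem const (c : X) : IsRegularAlong M l τ fun _ => c :=
  ⟨⟨c, tendsto_const_nhds⟩, fun _ => tendsto_const_nhds⟩

theorem congr (h : IsRegularAlong M l τ k) (hl : k =ᶠ[l] k') (hτ : k τ = k' τ) :
    IsRegularAlong M l τ k' :=
  ⟨h.1.imp fun _ hy => hy.congr' hl, fun hM => hτ ▸ (h.2 hM).congr' hl⟩

theorem add (h : IsRegularAlong M l τ k) (h' : IsRegularAlong M l τ k') :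
    IsRegularAlong M l τ (k + k') :=
  ⟨let ⟨_, hy⟩ := h.1; let ⟨_, hy'⟩ := h'.1; ⟨_, hy.add hy'⟩, fun hM => (h.2 hM).add (h'.2 hM)⟩

theorem of_isMajorant [CompleteSpace X] (h : IsMajorant M k) (hm : Tendsto M l (𝓝 m)) :
    IsRegularAlong M l τ k := by
  rcases l.eq_or_neBot with rfl | _
  · exact .bot k
  constructor
  · have cauchy := cauchy_map_iff'.1 hm.cauchy_map
    rw [tendsto_uniformity_iff_dist_tendsto_zero] at cauchy
    rw [← cauchy_map_iff_exists_tendsto, cauchy_map_iff', tendsto_uniformity_iff_dist_tendsto_zero]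
    refine squeeze_zero (fun _ => dist_nonneg) (fun p => ?_) cauchy
    rw [dist_eq_norm, Real.dist_eq]
    exact h.norm_sub_le _ _
  · intro hM
    rw [tendsto_iff_norm_sub_tendsto_zero] at hM ⊢
    exact squeeze_zero (fun _ => norm_nonneg _) (h.norm_sub_le τ) hM

theorem of_forall_approx [CompleteSpace X]
    (h : ∀ ε > 0, ∃ k', IsRegularAlong M l τ k' ∧ (∀ᶠ s in l, dist (k s) (k' s) < ε) ∧
      dist (k τ) (k' τ) < ε) : IsRegularAlong M l τ k := by
  rcases l.eq_or_neBot with rfl | _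
  · exact .bot k
  constructor
  · rw [← cauchy_map_iff_exists_tendsto, Metric.cauchy_iff]
    refine ⟨inferInstance, fun ε hε => ?_⟩
    obtain ⟨k', ⟨⟨y, hy⟩, -⟩, happrox, -⟩ := h (ε / 4) (by positivity)
    refine ⟨Metric.ball y (ε / 2), mem_map.2 ?_, fun p hp q hq => ?_⟩
    · filter_upwards [happrox, Metric.tendsto_nhds.1 hy (ε / 4) (by positivity)] with s h₁ h₂
      exact Metric.mem_ball.2 (by linarith [dist_triangle (k s) (k' s) y])
    · linarith [dist_triangle_right p q y, Metric.mem_ball.1 hp, Metric.mem_ball.1 hq]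
  · intro hM
    refine Metric.tendsto_nhds.2 fun ε hε => ?_
    obtain ⟨k', hk', happrox, hτ⟩ := h (ε / 3) (by positivity)
    filter_upwards [happrox, Metric.tendsto_nhds.1 (hk'.2 hM) (ε / 3) (by positivity)] with s h₁ h₂
    rw [dist_comm] at hτ
    linarith [dist_triangle4 (k s) (k' s) (k' τ) (k τ)]

theorem reflect (h : IsRegularAlong M l (-τ) k) (hl : Tendsto Neg.neg l' l)
    (hl' : Tendsto Neg.neg l l') : IsRegularAlong (fun t => -M (-t)) l' τ fun t => k (-t) := by
  refine ⟨h.1.imp fun _ hy => hy.comp hl, fun hM => (h.2 ?_).comp hl⟩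
  simpa [Function.comp_def] using (hM.comp hl').neg

end IsRegularAlong

theorem nhdsWithin_Icc_inter_Ioi (hτ : τ ∈ Ico a b) : 𝓝[Icc a b ∩ Ioi τ] τ = 𝓝[>] τ :=
  inter_comm (Icc a b) _ ▸ nhdsWithin_inter_of_mem'
    (le_principal_iff.1 ((nhdsGT_le_nhdsWithin_Icc hτ).trans inf_le_right))

theorem nhdsWithin_Icc_inter_Iio (hτ : τ ∈ Ioc a b) : 𝓝[Icc a b ∩ Iio τ] τ = 𝓝[<] τ :=
  inter_comm (Icc a b) _ ▸ nhdsWithin_inter_of_mem'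
    (le_principal_iff.1 ((nhdsLT_le_nhdsWithin_Icc hτ).trans inf_le_right))

theorem isRegularOn_Icc_iff : IsRegularOn M (Icc a b) k ↔
    (∀ τ ∈ Ico a b, IsRegularAlong M (𝓝[>] τ) τ k) ∧
      ∀ τ ∈ Ioc a b, IsRegularAlong M (𝓝[<] τ) τ k := by
  refine ⟨fun h => ⟨fun τ hτ => ?_, fun τ hτ => ?_⟩, fun h τ hτ => ⟨?_, ?_⟩⟩
  · exact nhdsWithin_Icc_inter_Ioi hτ ▸ (h τ (Ico_subset_Icc_self hτ)).2
  · exact nhdsWithin_Icc_inter_Iio hτ ▸ (h τ (Ioc_subset_Icc_self hτ)).1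
  · rcases hτ.1.eq_or_lt with rfl | haτ
    · rw [← Ici_inter_Iic, inter_right_comm, Ici_inter_Iio, Ico_self, empty_inter, nhdsWithin_empty]
      exact .bot k
    · exact nhdsWithin_Icc_inter_Iio ⟨haτ, hτ.2⟩ ▸ h.2 τ ⟨haτ, hτ.2⟩
  · rcases hτ.2.eq_or_lt with rfl | hτb
    · rw [← Ici_inter_Iic, inter_assoc, Iic_inter_Ioi, Ioc_self, inter_empty, nhdsWithin_empty]
      exact .bot k
    · exact nhdsWithin_Icc_inter_Ioi ⟨hτ.1, hτb⟩ ▸ h.1 τ ⟨hτ.1, hτb⟩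

namespace IsRegularOn

theorem nhdsGT (h : IsRegularOn M (Icc a b) k) (hτ : τ ∈ Ico a b) :
    IsRegularAlong M (𝓝[>] τ) τ k :=
  (isRegularOn_Icc_iff.1 h).1 τ hτ

theorem nhdsLT (h : IsRegularOn M (Icc a b) k) (hτ : τ ∈ Ioc a b) :
    IsRegularAlong M (𝓝[<] τ) τ k :=
  (isRegularOn_Icc_iff.1 h).2 τ hτ

theorem const (c : X) : IsRegularOn M S fun _ => c := fun _ _ => ⟨.const c, .const c⟩

theorem congr (h : IsRegularOn M S k) (hk : EqOn k k' S) : IsRegularOn M S k' := fun τ hτ =>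
  have near (T : Set ℝ) : k =ᶠ[𝓝[S ∩ T] τ] k' :=
    eventually_mem_nhdsWithin.mono fun _ hs => hk hs.1
  ⟨(h τ hτ).1.congr (near _) (hk hτ), (h τ hτ).2.congr (near _) (hk hτ)⟩

theorem add (h : IsRegularOn M S k) (h' : IsRegularOn M S k') : IsRegularOn M S (k + k') :=
  fun τ hτ => ⟨(h τ hτ).1.add (h' τ hτ).1, (h τ hτ).2.add (h' τ hτ).2⟩

theorem of_forall_approx [CompleteSpace X]
    (h : ∀ ε > 0, ∃ k', IsRegularOn M S k' ∧ ∀ s ∈ S, dist (k s) (k' s) < ε) :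
    IsRegularOn M S k := by
  intro τ hτ
  constructor <;> refine .of_forall_approx fun ε hε => ?_ <;> obtain ⟨k', hk', hε'⟩ := h ε hε
  · exact ⟨k', (hk' τ hτ).1, eventually_mem_nhdsWithin.mono fun s hs => hε' s hs.1, hε' τ hτ⟩
  · exact ⟨k', (hk' τ hτ).2, eventually_mem_nhdsWithin.mono fun s hs => hε' s hs.1, hε' τ hτ⟩

theorem and_eq_of_forall_approx [CompleteSpace X] {y : X}
    (h : ∀ ε > 0, ∃ k', (IsRegularOn M S k' ∧ k' a = y) ∧ ∀ t, dist (k t) (k' t) ≤ ε) :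
    IsRegularOn M S k ∧ k a = y := by
  refine ⟨of_forall_approx fun ε hε => ?_, eq_of_forall_dist_le fun ε hε => ?_⟩
  · obtain ⟨k', hk', hε'⟩ := h (ε / 2) (half_pos hε)
    exact ⟨k', hk'.1, fun t _ => (hε' t).trans_lt (half_lt_self hε)⟩
  · obtain ⟨k', hk', hε'⟩ := h ε hε
    exact hk'.2 ▸ hε' a

theorem mono_Icc {c d : ℝ} (h : IsRegularOn M (Icc a b) k) (hac : a ≤ c) (hdb : d ≤ b) :
    IsRegularOn M (Icc c d) k :=
  isRegularOn_Icc_iff.2 ⟨fun _ hτ => h.nhdsGT ⟨hac.trans hτ.1, hτ.2.trans_le hdb⟩,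
    fun _ hτ => h.nhdsLT ⟨hac.trans_lt hτ.1, hτ.2.trans hdb⟩⟩

theorem reflect (h : IsRegularOn M (Icc a b) k) :
    IsRegularOn (fun t => -M (-t)) (Icc (-b) (-a)) fun t => k (-t) :=
  isRegularOn_Icc_iff.2
    ⟨fun _ hτ => (h.nhdsLT ⟨lt_neg_of_lt_neg hτ.2, neg_le_of_neg_le hτ.1⟩).reflect
      tendsto_neg_nhdsGT tendsto_neg_nhdsLT_neg,
    fun _ hτ => (h.nhdsGT ⟨le_neg_of_le_neg hτ.2, neg_lt_of_neg_lt hτ.1⟩).reflect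
      tendsto_neg_nhdsLT tendsto_neg_nhdsGT_neg⟩

theorem exists_norm_le (h : IsRegularOn M S k) (hS : IsCompact S) :
    ∃ D, ∀ t ∈ S, ‖k t‖ ≤ D := by
  refine hS.induction_on (p := fun R => ∃ D, ∀ t ∈ R, ‖k t‖ ≤ D) ⟨0, by simp⟩ ?_ ?_ ?_
  · rintro R R' hRR' ⟨D, hD⟩
    exact ⟨D, fun t ht => hD t (hRR' ht)⟩
  · rintro R R' ⟨D, hD⟩ ⟨D', hD'⟩
    exact ⟨max D D', fun t ht => ht.elim (fun h => (hD t h).trans (le_max_left _ _))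
      fun h => (hD' t h).trans (le_max_right _ _)⟩
  · intro τ hτ
    obtain ⟨⟨⟨y, hy⟩, -⟩, ⟨⟨z, hz⟩, -⟩⟩ := h τ hτ
    have left := hy.norm.eventually (gt_mem_nhds (lt_add_one ‖y‖))
    have right := hz.norm.eventually (gt_mem_nhds (lt_add_one ‖z‖))
    let D := max ‖k τ‖ (max (‖y‖ + 1) (‖z‖ + 1))
    refine ⟨{t | ‖k t‖ ≤ D}, nhdsWithin_le_pure_sup_sup S τ ?_, D, fun _ ht => ht⟩
    exact ⟨mem_pure.2 (show ‖k τ‖ ≤ D from le_max_left _ _), left.mono fun t ht => by grind,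
      right.mono fun t ht => by grind⟩

end IsRegularOn

theorem IsMajorant.isRegularOn [CompleteSpace X] (h : IsMajorant M k) (S : Set ℝ) :
    IsRegularOn M S k := fun τ _ =>
  have one_sided {R : Set ℝ} : 𝓝[S ∩ R] τ ≤ 𝓝[R] τ := nhdsWithin_mono τ inter_subset_right
  ⟨.of_isMajorant h ((h.monotone.tendsto_nhdsLT τ).mono_left one_sided),
   .of_isMajorant h ((h.monotone.tendsto_nhdsGT τ).mono_left one_sided)⟩

end Regularity

section Primitive

variable {E G : Type*} [NormedAddCommGroup E] [NormedSpace ℝ E] [NormedAddCommGroup G]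
  [NormedSpace ℝ G] {M : ℝ → ℝ} {A : ℝ → E →L[ℝ] G} {g : ℝ → E} {F : ℝ → G} {l : Filter ℝ}
  {S : Set ℝ} {L : E →L[ℝ] G} {a b ε τ : ℝ} {y : E}

theorem IsPrimitive.tendsto_residual (hM : Monotone M) (h : IsPrimitive M A g F S) (hτ : τ ∈ S) :
    Tendsto (residual A g F τ) (𝓝[S] τ) (𝓝 0) := by
  have bounded : (fun v => M v - M τ) =O[𝓝[S] τ] fun _ => (1 : ℝ) := by
    refine IsBigO.of_bound (M (τ + 1) - M (τ - 1)) ?_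
    filter_upwards [nhdsWithin_le_nhds (Icc_mem_nhds (sub_one_lt τ) (lt_add_one τ))] with v hv
    rw [norm_one, mul_one, Real.norm_eq_abs, abs_sub_le_iff]
    constructor <;> linarith [hM hv.1, hM hv.2, hM (sub_one_lt τ).le, hM (lt_add_one τ).le]
  exact (isLittleO_one_iff ℝ).1 ((h τ hτ).trans_isBigO bounded)

theorem tendsto_sub_apply (hL : Tendsto A l (𝓝 L)) (B : E →L[ℝ] G) (y : E) :
    Tendsto (fun v => (A v - B) y) l (𝓝 ((L - B) y)) :=
  ((ContinuousLinearMap.apply ℝ G y).continuous.tendsto _).comp (hL.sub_const B)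

theorem tendsto_of_tendsto_residual (hL : Tendsto A l (𝓝 L))
    (h : Tendsto (residual A g F τ) l (𝓝 0)) :
    Tendsto F l (𝓝 (F τ + (L - A τ) (g τ))) := by
  simpa [residual] using (h.add (tendsto_sub_apply hL (A τ) (g τ))).const_add (F τ)

theorem IsRegularAlong.of_residual (hA : IsRegularAlong M l τ A)
    (h : Tendsto (residual A g F τ) l (𝓝 0)) : IsRegularAlong M l τ F := by
  refine ⟨hA.1.elim fun L hL => ⟨_, tendsto_of_tendsto_residual hL h⟩, fun hM => ?_⟩
  simpa using tendsto_of_tendsto_residual (hA.2 hM) h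

theorem IsPrimitive.isRegularOn [CompleteSpace G] (hA : IsMajorant M A)
    (h : IsPrimitive M A g F S) : IsRegularOn M S F := fun τ hτ =>
  have hres := h.tendsto_residual hA.monotone hτ
  ⟨(hA.isRegularOn S τ hτ).1.of_residual (hres.mono_left (nhdsWithin_mono τ inter_subset_left)),
   (hA.isRegularOn S τ hτ).2.of_residual (hres.mono_left (nhdsWithin_mono τ inter_subset_left))⟩

theorem isLittleO_increment_of_tendsto {X : Type*} [NormedAddCommGroup X] {k : ℝ → X} {m : ℝ}
    (hm : Tendsto M l (𝓝 m)) (hk : Tendsto k l (𝓝 0)) (hk₀ : m = M τ → k =ᶠ[l] 0) :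
    k =o[l] fun v => M v - M τ := by
  rcases eq_or_ne m (M τ) with h | h
  · exact (isLittleO_zero _ l).congr' (hk₀ h).symm .rfl
  · have hpos : 0 < ‖m - M τ‖ := norm_pos_iff.2 (sub_ne_zero.2 h)
    exact ((isLittleO_one_iff ℝ).2 hk).trans_isBigO <|
      (isBigO_const_left_iff_pos_le_norm one_ne_zero).2
        ⟨_, half_pos hpos, (hm.sub_const (M τ)).norm.eventually_const_le (half_lt_self hpos)⟩

theorem isApproxPrimitive_update (hA : IsMajorant M A) (hε : 0 < ε) {m : ℝ}
    (hm : Tendsto M (𝓝[S \ {τ}] τ) (𝓝 m)) (hL : Tendsto A (𝓝[S \ {τ}] τ) (𝓝 L))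
    (hy : Tendsto g (𝓝[S \ {τ}] τ) (𝓝 y)) (hmy : m = M τ → y = g τ)
    (hgy : ∀ s ∈ S \ {τ}, ‖y - g s‖ ≤ ε) :
    IsApproxPrimitive ε M A g (Function.update (fun s => (L - A τ) (g τ) + (A s - L) y) τ 0) S := by
  intro σ hσ
  rcases eq_or_ne σ τ with rfl | hne
  · have near : 𝓝[S] σ ≤ pure σ ⊔ 𝓝[S \ {σ}] σ := by
      rw [← nhdsWithin_insert, insert_sdiff_singleton]
      exact nhdsWithin_mono σ (subset_insert σ S)
    refine IsBigOWith.mono (isBigOWith_iff.2 (eventually_sup.2 ⟨?_, ?_⟩)) near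
    · simp [residual]
    have residual_eq : (fun s => (A s - L) (y - g σ)) =ᶠ[𝓝[S \ {σ}] σ]
        residual A g (Function.update (fun s => (L - A σ) (g σ) + (A s - L) y) σ 0) σ :=
      eventually_mem_nhdsWithin.mono fun s hs => by
        simp only [residual, Function.update_of_ne hs.2, Function.update_self, map_sub,
          _root_.sub_apply]
        abel
    refine ((isLittleO_increment_of_tendsto hm ?_ fun h => ?_).congr' residual_eq .rfl
      |>.forall_isBigOWith hε).bound
    · simpa using tendsto_sub_apply hL L (y - g σ)
    · exact .of_forall fun s => by simp [hmy h]
  · refine isBigOWith_iff.2 ?_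
    filter_upwards [nhdsWithin_le_nhds (isOpen_ne.mem_nhds hne)] with s hs
    calc ‖residual A g _ σ s‖ = ‖(A s - A σ) (y - g σ)‖ := by
          simp only [residual, Function.update_of_ne hne, Function.update_of_ne hs, map_sub,
            _root_.sub_apply]
          congr 1; abel
      _ ≤ |M s - M σ| * ε :=
        ContinuousLinearMap.le_of_opNorm_le_of_le _ (hA.norm_sub_le σ s) (hgy σ ⟨hσ, hne⟩)
      _ = ε * ‖M s - M σ‖ := mul_comm _ _

theorem eventually_smallSets_exists_isApproxPrimitive [CompleteSpace G] (hA : IsMajorant M A)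
    (hε : 0 < ε) {m : ℝ} [(𝓝[S] τ).NeBot] (hm : Tendsto M (𝓝[S] τ) (𝓝 m))
    (hg : IsRegularAlong M (𝓝[S] τ) τ g) :
    ∀ᶠ R in (𝓝[insert τ S] τ).smallSets, ∃ F, IsApproxPrimitive ε M A g F R := by
  obtain ⟨L, hL⟩ := (IsRegularAlong.of_isMajorant (τ := τ) hA hm).1
  obtain ⟨⟨y, hy⟩, hgτ⟩ := hg
  have near : {s | s ∈ S → ‖y - g s‖ ≤ ε} ∈ 𝓝 τ := by
    filter_upwards [eventually_nhdsWithin_iff.1 (hy (Metric.closedBall_mem_nhds y hε))]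
      with s hs hsS
    rw [norm_sub_rev]
    exact mem_closedBall_iff_norm.1 (hs hsS)
  refine eventually_smallSets.2 ⟨_, inter_mem_nhdsWithin _ near, fun R hR => ?_⟩
  have hRS : R \ {τ} ⊆ S := fun s hs => (hR hs.1).1.resolve_left hs.2
  have hle : 𝓝[R \ {τ}] τ ≤ 𝓝[S] τ := nhdsWithin_mono τ hRS
  exact ⟨_, isApproxPrimitive_update hA hε (hm.mono_left hle) (hL.mono_left hle)
    (hy.mono_left hle) (fun h => tendsto_nhds_unique hy (hgτ (h ▸ hm)))
    fun s hs => (hR hs.1).2 (hRS hs)⟩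

theorem tendsto_Icc_smallSets_nhdsGE (τ : ℝ) :
    Tendsto (Icc τ) (𝓝[>] τ) (𝓝[insert τ (Ioi τ)] τ).smallSets := by
  rw [Ioi_insert]
  refine tendsto_smallSets_iff.2 fun R hR => ?_
  obtain ⟨w, hw, hwR⟩ := mem_nhdsGE_iff_exists_Icc_subset.1 hR
  filter_upwards [Ioc_mem_nhdsGT hw] with v hv
  exact (Icc_subset_Icc_right hv.2).trans hwR

theorem tendsto_Icc_smallSets_nhdsLE (τ : ℝ) :
    Tendsto (fun u => Icc u τ) (𝓝[<] τ) (𝓝[insert τ (Iio τ)] τ).smallSets := by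
  rw [Iio_insert]
  refine tendsto_smallSets_iff.2 fun R hR => ?_
  obtain ⟨w, hw, hwR⟩ := mem_nhdsLE_iff_exists_Icc_subset.1 hR
  filter_upwards [Ico_mem_nhdsLT hw] with u hu
  exact (Icc_subset_Icc_left hu.1).trans hwR

theorem exists_isApproxPrimitive [CompleteSpace G] (hA : IsMajorant M A)
    (hg : IsRegularOn M (Icc a b) g) (hab : a < b) (hε : 0 < ε) :
    ∃ F, IsApproxPrimitive ε M A g F (Icc a b) := by
  refine cousin_induction (Q := fun u v => ∃ F, IsApproxPrimitive ε M A g F (Icc u v)) hab ?_ ?_ ?_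
  · rintro u v w - huv hvw - ⟨F, hF⟩ ⟨F', hF'⟩
    have glued := hF.piecewise (hF'.add_const (F v - F' v)) huv.le hvw.le rfl
      (add_sub_cancel _ _).symm
    rw [piecewise_same] at glued
    exact ⟨_, glued⟩
  · exact fun τ hτ => (tendsto_Icc_smallSets_nhdsGE τ).eventually
      (eventually_smallSets_exists_isApproxPrimitive hA hε (hA.monotone.tendsto_nhdsGT τ)
        (hg.nhdsGT hτ))
  · exact fun τ hτ => (tendsto_Icc_smallSets_nhdsLE τ).eventually
      (eventually_smallSets_exists_isApproxPrimitive hA hε (hA.monotone.tendsto_nhdsLT τ)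
        (hg.nhdsLT hτ))

theorem exists_forall_norm_sub_sub_le [CompleteSpace G] (hM : Monotone M) {e : ℕ → ℝ}
    (he : Antitone e) (he₀ : Tendsto e atTop (𝓝 0)) {H : ℕ → ℝ → G}
    (hH : ∀ n, IsApproxPrimitive (e n) M A g (H n) (Icc a b)) (hab : a ≤ b) :
    ∃ F : ℝ → G, ∀ n, ∀ s ∈ Icc a b, ∀ t ∈ Icc a b,
      ‖F t - H n t - (F s - H n s)‖ ≤ e n * |M t - M s| := by
  have close : ∀ n m, ∀ s ∈ Icc a b, ∀ t ∈ Icc a b,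
      ‖H m t - H n t - (H m s - H n s)‖ ≤ (e m + e n) * |M t - M s| := fun n m s hs t ht =>
    (hH m).norm_sub_sub_le hM (hH n) hs ht
  have lim : ∀ t ∈ Icc a b, Tendsto (fun n => H n t - H n a) atTop
      (𝓝 (limUnder atTop fun n => H n t - H n a)) := fun t ht => by
    refine (cauchySeq_of_le_tendsto_0 (fun N => (e N + e N) * |M t - M a|) ?_ ?_).tendsto_limUnder
    · intro n m N hn hm
      rw [dist_eq_norm, sub_sub_sub_comm]
      refine (close m n a (left_mem_Icc.2 hab) t ht).trans ?_
      gcongr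
      exacts [he hn, he hm]
    · simpa using (he₀.add he₀).mul_const |M t - M a|
  refine ⟨fun t => limUnder atTop fun n => H n t - H n a, fun n s hs t ht => ?_⟩
  have bound : Tendsto (fun m => (e m + e n) * |M t - M s|) atTop (𝓝 ((0 + e n) * |M t - M s|)) :=
    (he₀.add_const _).mul_const _
  rw [zero_add] at bound
  refine le_of_tendsto_of_tendsto'
    (((lim t ht).sub_const (H n t)).sub ((lim s hs).sub_const (H n s))).norm bound fun m => ?_
  calc ‖H m t - H m a - H n t - (H m s - H m a - H n s)‖ = ‖H m t - H n t - (H m s - H n s)‖ := by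
        congr 1; abel
    _ ≤ (e m + e n) * |M t - M s| := close n m s hs t ht

theorem exists_isPrimitive [CompleteSpace G] (hA : IsMajorant M A)
    (hg : IsRegularOn M (Icc a b) g) (hab : a < b) : ∃ F, IsPrimitive M A g F (Icc a b) := by
  let e : ℕ → ℝ := fun n => 1 / ((n : ℝ) + 1)
  have he₀ : Tendsto e atTop (𝓝 0) := tendsto_one_div_add_atTop_nhds_zero_nat
  choose H hH using fun n => exists_isApproxPrimitive hA hg hab (Nat.one_div_pos_of_nat (n := n))
  obtain ⟨F, hF⟩ := exists_forall_norm_sub_sub_le hA.monotone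
    (fun _ _ h => Nat.one_div_le_one_div h) he₀ hH hab.le
  refine ⟨F, isPrimitive_iff_forall_isApproxPrimitive.2 fun ε hε τ hτ => ?_⟩
  obtain ⟨n, hn⟩ := (he₀.eventually (gt_mem_nhds (half_pos hε))).exists
  refine isBigOWith_iff.2 ?_
  filter_upwards [(hH n τ hτ).bound, self_mem_nhdsWithin] with v hres hv
  calc ‖residual A g F τ v‖ = ‖F v - H n v - (F τ - H n τ) + residual A g (H n) τ v‖ := by
        simp only [residual]; congr 1; abel
    _ ≤ e n * |M v - M τ| + e n * |M v - M τ| := norm_add_le_of_le (hF n τ hτ v hv) hres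
    _ ≤ ε * |M v - M τ| := by rw [← add_mul]; gcongr; linarith

end Primitive

theorem edist_uniformFun_le_ofReal_iff {α X : Type*} [PseudoMetricSpace X] {x x' : α →ᵤ X} {D : ℝ}
    (hD : 0 ≤ D) : edist x x' ≤ ENNReal.ofReal D ↔
      ∀ t, dist (UniformFun.toFun x t) (UniformFun.toFun x' t) ≤ D := by
  simp only [UniformFun.edist_le, edist_dist, ENNReal.ofReal_le_ofReal_iff hD]

theorem exists_fixedPoint_of_dist_le_half {α X : Type*} [MetricSpace X] [CompleteSpace X]
    {s : Set (α → X)} {T : (α → X) → α → X} (maps : MapsTo T s s)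
    (closed : ∀ x, (∀ ε > 0, ∃ x' ∈ s, ∀ t, dist (x t) (x' t) ≤ ε) → x ∈ s)
    (contracting : ∀ x ∈ s, ∀ x' ∈ s, ∀ D : ℝ, (∀ t, dist (x t) (x' t) ≤ D) →
      ∀ t, dist (T x t) (T x' t) ≤ D / 2)
    {x₀ : α → X} (hx₀ : x₀ ∈ s) {D : ℝ} (hD₀ : 0 ≤ D)
    (hD : ∀ t, dist (x₀ t) (T x₀ t) ≤ D) :
    ∃ x ∈ s, T x = x := by
  let s' : Set (α →ᵤ X) := UniformFun.toFun ⁻¹' s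
  let T' : (α →ᵤ X) → α →ᵤ X := fun x => UniformFun.ofFun (T (UniformFun.toFun x))
  have complete : IsComplete s' := IsClosed.isComplete <|
    isClosed_of_closure_subset fun x hx => closed _ fun ε hε => by
      obtain ⟨x', hx', hxx'⟩ := EMetric.mem_closure_iff.1 hx _ (ENNReal.ofReal_pos.2 hε)
      exact ⟨_, hx', (edist_uniformFun_le_ofReal_iff hε.le).1 hxx'.le⟩
  have maps' : MapsTo T' s' s' := fun x hx => maps hx
  have contracting' : ContractingWith 2⁻¹ (maps'.restrict T' s' s') := by
    refine ⟨by norm_num, fun ⟨x, hx⟩ ⟨x', hx'⟩ => ?_⟩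
    simp only [Subtype.edist_mk_mk, MapsTo.restrict, Subtype.map]
    rcases eq_or_ne (edist x x') ⊤ with htop | htop
    · simp [htop, ENNReal.mul_top]
    · have hhalf : ((2⁻¹ : NNReal) : ENNReal) * edist x x' =
          ENNReal.ofReal ((edist x x').toReal / 2) := by
        rw [ENNReal.ofReal_div_of_pos two_pos, ENNReal.ofReal_toReal htop, ENNReal.ofReal_ofNat,
          ENNReal.div_eq_inv_mul, ENNReal.coe_inv two_ne_zero, ENNReal.coe_ofNat]
      rw [hhalf, edist_uniformFun_le_ofReal_iff (by positivity)]
      refine contracting _ hx _ hx' _ ((edist_uniformFun_le_ofReal_iff ENNReal.toReal_nonneg).1 ?_)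
      rw [ENNReal.ofReal_toReal htop]
  obtain ⟨x, hx, hfix, -⟩ := contracting'.exists_fixedPoint' complete maps'
    (x := UniformFun.ofFun x₀) hx₀ <|
    ne_top_of_le_ne_top ENNReal.ofReal_ne_top ((edist_uniformFun_le_ofReal_iff hD₀).2 hD)
  exact ⟨_, hx, congrArg UniformFun.toFun hfix⟩

section Solution

variable {E : Type*} [NormedAddCommGroup E] [NormedSpace ℝ E] {M : ℝ → ℝ} {A : ℝ → E →L[ℝ] E}
  {f g g' x x' F F' : ℝ → E} {S T : Set ℝ} {a b t v τ D : ℝ}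

/-- `x` solves `dx/dτ = D[A(t)x + f(t)]` on `S`, in the differential form of `IsPrimitive`. -/
def IsSolutionOn (M : ℝ → ℝ) (A : ℝ → E →L[ℝ] E) (f x : ℝ → E) (S : Set ℝ) : Prop :=
  IsPrimitive M A x (x - f) S

namespace IsSolutionOn

theorem mono_set (h : IsSolutionOn M A f x S) (hT : T ⊆ S) : IsSolutionOn M A f x T :=
  IsPrimitive.mono_set h hT

theorem congr (h : IsSolutionOn M A f x S) (hx : EqOn x x' S) : IsSolutionOn M A f x' S :=
  IsPrimitive.congr h hx fun t ht => by rw [Pi.sub_apply, Pi.sub_apply, hx ht]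

theorem add_homogeneous (h : IsSolutionOn M A f x S) (h' : IsSolutionOn M A 0 x' S) :
    IsSolutionOn M A f (x + x') S :=
  (IsPrimitive.add h h').congr (fun _ _ => rfl) fun t _ => by
    simp only [Pi.add_apply, Pi.sub_apply, Pi.zero_apply]; abel

theorem sub (h : IsSolutionOn M A f x S) (h' : IsSolutionOn M A f x' S) :
    IsSolutionOn M A 0 (x - x') S :=
  (IsPrimitive.sub h h').congr (fun _ _ => rfl) fun t _ => by
    simp only [Pi.sub_apply, Pi.zero_apply]; abel

theorem reflect (h : IsSolutionOn M A f x (Icc a b)) :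
    IsSolutionOn (fun t => -M (-t)) (fun t => A (-t)) (fun t => f (-t)) (fun t => x (-t))
      (Icc (-b) (-a)) :=
  IsPrimitive.reflect h

theorem piecewise (h : IsSolutionOn M A f x (Icc a v)) (h' : IsSolutionOn M A f x' (Icc v b))
    (hav : a ≤ v) (hvb : v ≤ b) (hx : x v = x' v) :
    IsSolutionOn M A f ((Iic v).piecewise x x') (Icc a b) := by
  have glued := IsPrimitive.piecewise h h' hav hvb hx
    (show (x - f) v = (x' - f) v by rw [Pi.sub_apply, Pi.sub_apply, hx])
  refine glued.congr (fun _ _ => rfl) fun t _ => ?_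
  by_cases ht : t ∈ Iic v <;> simp [ht]

theorem isRegularOn [CompleteSpace E] (hA : IsMajorant M A) (h : IsSolutionOn M A f x S)
    (hf : IsRegularOn M S f) : IsRegularOn M S x :=
  sub_add_cancel x f ▸ (IsPrimitive.isRegularOn hA h).add hf

theorem tendsto_homogeneous {l : Filter ℝ} {L : E →L[ℝ] E} (hM : Monotone M)
    (h : IsSolutionOn M A 0 x S) (hτ : τ ∈ S) (hl : l ≤ 𝓝[S] τ) (hL : Tendsto A l (𝓝 L)) :
    Tendsto x l (𝓝 ((1 + (L - A τ)) (x τ))) := by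
  have lim := tendsto_of_tendsto_residual hL ((h.tendsto_residual hM hτ).mono_left hl)
  simpa only [sub_zero, _root_.add_apply, one_apply_eq_self] using lim

end IsSolutionOn

/-- `M` varies by at most `1/2` on `(a, b]`. -/
def IsShort (M : ℝ → ℝ) (a b : ℝ) : Prop :=
  ∀ u ∈ Ioc a b, ∀ v ∈ Ioc a b, |M v - M u| ≤ 1 / 2

theorem eventually_isShort (hM : Monotone M) (τ : ℝ) : ∀ᶠ v in 𝓝[>] τ, IsShort M τ v := by
  obtain ⟨w, hw, hlim⟩ := mem_nhdsGT_iff_exists_Ioc_subset.1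
    ((hM.tendsto_nhdsGT τ).eventually (Metric.closedBall_mem_nhds _ (ε := 1 / 4) (by norm_num)))
  filter_upwards [Ioc_mem_nhdsGT hw] with v hv u hu u' hu'
  have near {r : ℝ} (hr : r ∈ Ioc τ v) : dist (M r) (sInf (M '' Ioi τ)) ≤ 1 / 4 :=
    hlim ⟨hr.1, hr.2.trans hv.2⟩
  rw [← Real.dist_eq]
  linarith [dist_triangle_right (M u') (M u) (sInf (M '' Ioi τ)), near hu, near hu']

theorem IsPrimitive.norm_sub_le_half (hA : IsMajorant M A) (h : IsPrimitive M A g F (Icc a b))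
    (hshort : IsShort M a b) (hga : g a = 0) (hg : ∀ t ∈ Icc a b, ‖g t‖ ≤ D)
    (ht : t ∈ Icc a b) : ‖F t - F a‖ ≤ D / 2 := by
  have hD : 0 ≤ D := (norm_nonneg _).trans (hg t ht)
  rcases ht.1.eq_or_lt with rfl | hat
  · rw [sub_self, norm_zero]; positivity
  have haS : a ∈ Ico a b := ⟨le_rfl, hat.trans_le ht.2⟩
  have right_continuous : Tendsto F (𝓝[>] a) (𝓝 (F a)) := by
    have lim := h.tendsto_residual hA.monotone (Ico_subset_Icc_self haS)
    simpa [residual, hga] using (lim.mono_left (nhdsGT_le_nhdsWithin_Icc haS)).add_const (F a)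
  refine le_of_tendsto (right_continuous.const_sub (F t)).norm ?_
  filter_upwards [Ioo_mem_nhdsGT hat] with u hu
  calc ‖F t - F u‖ ≤ D * |M t - M u| := h.norm_sub_le hA hg ⟨hu.1.le, hu.2.le.trans ht.2⟩ ht
    _ ≤ D * (1 / 2) := by gcongr; exact hshort u ⟨hu.1, hu.2.le.trans ht.2⟩ t ⟨hat, ht.2⟩
    _ = D / 2 := by ring

theorem IsPrimitive.dist_sub_le_half (hA : IsMajorant M A) (h : IsPrimitive M A g F (Icc a b))
    (h' : IsPrimitive M A g' F' (Icc a b)) (hshort : IsShort M a b) (hga : g a = g' a)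
    (hg : ∀ t ∈ Icc a b, dist (g t) (g' t) ≤ D) (ht : t ∈ Icc a b) :
    dist (F t - F a) (F' t - F' a) ≤ D / 2 := by
  rw [dist_eq_norm, sub_sub_sub_comm]
  exact (h.sub h').norm_sub_le_half hA hshort (sub_eq_zero.2 hga)
    (fun t ht => dist_eq_norm (g t) (g' t) ▸ hg t ht) ht

variable [CompleteSpace E]

theorem exists_isSolutionOn_of_isShort (hA : IsMajorant M A) (hf : IsRegularOn M (Icc a b) f)
    (hab : a < b) (hshort : IsShort M a b) (y : E) :
    ∃ x, IsSolutionOn M A f x (Icc a b) ∧ x a = y := by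
  have haI : a ∈ Icc a b := left_mem_Icc.2 hab.le
  choose! I hI using fun x (hx : IsRegularOn M (Icc a b) x) => exists_isPrimitive hA hx hab
  let s : Set (ℝ → E) := {x | IsRegularOn M (Icc a b) x ∧ x a = y}
  let T : (ℝ → E) → ℝ → E := fun x => (Icc a b).indicator fun t => I x t - I x a + (f t - f a + y)
  have T_apply {x : ℝ → E} : EqOn (T x) (fun t => I x t - I x a + (f t - f a + y)) (Icc a b) :=
    eqOn_indicator
  have maps : MapsTo T s s := fun x hx =>
    ⟨((((hI x hx.1).isRegularOn hA).add hf).add (.const (y - I x a - f a))).congr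
      fun t ht => by simp only [T_apply ht, Pi.add_apply]; abel,
    by simp only [T_apply haI, sub_self, zero_add]⟩
  have contracting : ∀ x ∈ s, ∀ x' ∈ s, ∀ D : ℝ, (∀ t, dist (x t) (x' t) ≤ D) →
      ∀ t, dist (T x t) (T x' t) ≤ D / 2 := fun x hx x' hx' D hD t => by
    by_cases ht : t ∈ Icc a b
    · rw [T_apply ht, T_apply ht, dist_add_right]
      exact (hI x hx.1).dist_sub_le_half hA (hI x' hx'.1) hshort (hx.2.trans hx'.2.symm)
        (fun t _ => hD t) ht
    · simp only [T, indicator_of_notMem ht, dist_self]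
      linarith [dist_nonneg.trans (hD t)]
  have const_mem : (fun _ => y) ∈ s := ⟨.const y, rfl⟩
  obtain ⟨D, hD⟩ := (maps const_mem).1.exists_norm_le isCompact_Icc
  have bound : ∀ t, dist y (T (fun _ => y) t) ≤ ‖y‖ + D := fun t => by
    have hD₀ : 0 ≤ D := (norm_nonneg _).trans (hD a haI)
    refine (dist_le_norm_add_norm _ _).trans (add_le_add_right ?_ _)
    by_cases ht : t ∈ Icc a b
    exacts [hD t ht, by simpa only [T, indicator_of_notMem ht, norm_zero]]
  obtain ⟨x, hx, hfix⟩ := exists_fixedPoint_of_dist_le_half maps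
    (fun _ => IsRegularOn.and_eq_of_forall_approx) contracting const_mem
    (dist_nonneg.trans (bound a)) bound
  refine ⟨x, ((hI x hx.1).add_const (y - I x a - f a)).congr (fun _ _ => rfl) fun t ht => ?_, hx.2⟩
  have fixed : I x t - I x a + (f t - f a + y) = x t := (T_apply ht).symm.trans (congrFun hfix t)
  simp only [Pi.sub_apply, ← fixed]
  abel

end Solution

section InitialValueProblem

variable {E : Type*} [NormedAddCommGroup E] [NormedSpace ℝ E] {M : ℝ → ℝ} {A : ℝ → E →L[ℝ] E}
  {f x x' : ℝ → E} {a b c s t v τ : ℝ}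

/-- `A` has a limit along `l`, and the jump of `A` from `τ` to this limit is an invertible
perturbation of the identity. -/
def HasInvertibleJumpAlong (l : Filter ℝ) (τ : ℝ) (A : ℝ → E →L[ℝ] E) : Prop :=
  ∃ L, Tendsto A l (𝓝 L) ∧ IsUnit (1 + (L - A τ))

/-- Condition (H), phrased with limits of `A` instead of `Function.leftLim` and
`Function.rightLim`; this form is symmetric under reflection of the line. -/
def HasInvertibleJumps (A : ℝ → E →L[ℝ] E) : Prop :=
  ∀ τ, HasInvertibleJumpAlong (𝓝[<] τ) τ A ∧ HasInvertibleJumpAlong (𝓝[>] τ) τ A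

theorem HasInvertibleJumps.reflect (h : HasInvertibleJumps A) :
    HasInvertibleJumps fun t => A (-t) := fun τ =>
  ⟨(h (-τ)).2.imp fun _ hL => ⟨hL.1.comp tendsto_neg_nhdsLT, hL.2⟩,
    (h (-τ)).1.imp fun _ hL => ⟨hL.1.comp tendsto_neg_nhdsGT, hL.2⟩⟩

theorem IsSolutionOn.eq_zero_of_isShort [CompleteSpace E] (hA : IsMajorant M A)
    (h : IsSolutionOn M A 0 x (Icc a b)) (hshort : IsShort M a b) (ha : x a = 0)
    (ht : t ∈ Icc a b) : x t = 0 := by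
  obtain ⟨D, hD⟩ := (h.isRegularOn hA (.const 0)).exists_norm_le isCompact_Icc
  have decay : ∀ n : ℕ, ∀ t ∈ Icc a b, ‖x t‖ ≤ D / 2 ^ n := fun n => by
    induction n with
    | zero => simpa using hD
    | succ n ih =>
      intro t ht
      have half := IsPrimitive.norm_sub_le_half hA h hshort ha ih ht
      simpa only [sub_zero, ha, div_div, ← pow_succ] using half
  have lim : Tendsto (fun n : ℕ => D / 2 ^ n) atTop (𝓝 0) :=
    tendsto_const_nhds.div_atTop (tendsto_pow_atTop_atTop_of_one_lt one_lt_two)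
  exact norm_le_zero_iff.1 (ge_of_tendsto' lim fun n => decay n t ht)

theorem IsSolutionOn.eventually_eq_zero_iff [CompleteSpace E] (hA : IsMajorant M A)
    (hJ : HasInvertibleJumps A) (h : IsSolutionOn M A 0 x (Icc a b)) (hτ : τ ∈ Ico a b) :
    ∀ᶠ v in 𝓝[>] τ, x τ = 0 ↔ x v = 0 := by
  by_cases h₀ : x τ = 0
  · filter_upwards [eventually_isShort hA.monotone τ, Ioc_mem_nhdsGT hτ.2] with v hshort hv
    exact iff_of_true h₀ ((h.mono_set (Icc_subset_Icc hτ.1 hv.2)).eq_zero_of_isShort hA hshort h₀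
      (right_mem_Icc.2 hv.1.le))
  · obtain ⟨L, hL, hunit⟩ := (hJ τ).2
    have lim := h.tendsto_homogeneous hA.monotone (Ico_subset_Icc_self hτ)
      (nhdsGT_le_nhdsWithin_Icc hτ) hL
    have hne : (1 + (L - A τ)) (x τ) ≠ 0 := fun h₁ =>
      h₀ ((ContinuousLinearMap.isUnit_iff_bijective.1 hunit).injective (h₁.trans (map_zero _).symm))
    exact (lim.eventually_ne hne).mono fun v hv => iff_of_false h₀ hv

theorem IsSolutionOn.eq_zero_iff [CompleteSpace E] (hA : IsMajorant M A)
    (hJ : HasInvertibleJumps A) (h : IsSolutionOn M A 0 x (Icc a b)) (hs : s ∈ Icc a b)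
    (ht : t ∈ Icc a b) : x s = 0 ↔ x t = 0 := by
  wlog hst : s ≤ t generalizing s t
  · exact (this ht hs (le_of_not_ge hst)).symm
  rcases hst.eq_or_lt with rfl | hst
  · rfl
  have hsub : Icc s t ⊆ Icc a b := Icc_subset_Icc hs.1 ht.2
  refine cousin_induction (Q := fun u v => x u = 0 ↔ x v = 0) hst
    (fun _ _ _ _ _ _ _ => Iff.trans) (fun τ hτ => (h.mono_set hsub).eventually_eq_zero_iff hA hJ hτ)
    fun τ hτ => ?_
  have reflected := (h.mono_set hsub).reflect.eventually_eq_zero_iff hA.reflect hJ.reflect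
    (τ := -τ) ⟨neg_le_neg hτ.2, neg_lt_neg hτ.1⟩
  filter_upwards [tendsto_neg_nhdsLT.eventually reflected] with u hu
  simpa only [neg_neg] using hu.symm

theorem IsSolutionOn.eqOn [CompleteSpace E] (hA : IsMajorant M A) (hJ : HasInvertibleJumps A)
    (h : IsSolutionOn M A f x (Icc a b)) (h' : IsSolutionOn M A f x' (Icc a b))
    (hc : c ∈ Icc a b) (hxc : x c = x' c) : EqOn x x' (Icc a b) := fun _ ht =>
  sub_eq_zero.1 <| ((h.sub h').eq_zero_iff hA hJ hc ht).1 (sub_eq_zero.2 hxc)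

/-- `A` acting on operators by composition from the left, so that operator-valued functions can be
treated as solutions of the same kind of equation. -/
noncomputable def leftMul (A : ℝ → E →L[ℝ] E) (t : ℝ) : (E →L[ℝ] E) →L[ℝ] E →L[ℝ] E :=
  ContinuousLinearMap.mul ℝ (E →L[ℝ] E) (A t)

protected theorem IsMajorant.leftMul (hA : IsMajorant M A) : IsMajorant M (leftMul A) where
  monotone := hA.monotone
  norm_sub_le s t := by
    rw [leftMul, leftMul, ← map_sub]
    exact (ContinuousLinearMap.opNorm_mul_apply_le ℝ _ _).trans (hA.norm_sub_le s t)

protected theorem HasInvertibleJumpAlong.leftMul {l : Filter ℝ} (h : HasInvertibleJumpAlong l τ A) :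
    HasInvertibleJumpAlong l τ (leftMul A) := by
  obtain ⟨L, hL, u, hu⟩ := h
  let mul := ContinuousLinearMap.mul ℝ (E →L[ℝ] E)
  refine ⟨mul L, (mul.continuous.tendsto L).comp hL, ⟨mul u, mul ↑u⁻¹, ?_, ?_⟩, ?_⟩ <;> ext V y
  · simp [mul]
  · simp [mul]
  · simp [mul, leftMul, hu]

protected theorem HasInvertibleJumps.leftMul (h : HasInvertibleJumps A) :
    HasInvertibleJumps (leftMul A) :=
  fun τ => ⟨(h τ).1.leftMul, (h τ).2.leftMul⟩

theorem residual_leftMul_apply (V W : ℝ → E →L[ℝ] E) (y : E) (τ v : ℝ) :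
    residual A (fun t => V t y) (fun t => W t y) τ v = residual (leftMul A) V W τ v y := by
  simp only [residual, leftMul, _root_.sub_apply, ContinuousLinearMap.mul_apply',
    mul_apply_eq_comp]

theorem IsSolutionOn.apply {V : ℝ → E →L[ℝ] E} {S : Set ℝ}
    (h : IsSolutionOn M (leftMul A) 0 V S) (y : E) :
    IsSolutionOn M A 0 (fun t => V t y) S :=
  IsPrimitive.map h (ContinuousLinearMap.apply ℝ E y) fun τ v => by
    simpa using residual_leftMul_apply V V y τ v

theorem IsSolutionOn.tendsto_leftMul {V : ℝ → E →L[ℝ] E} {S : Set ℝ} {l : Filter ℝ}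
    {L : E →L[ℝ] E} (hM : Monotone M) (h : IsSolutionOn M (leftMul A) 0 V S) (hτ : τ ∈ S)
    (hl : l ≤ 𝓝[S] τ) (hL : Tendsto A l (𝓝 L)) :
    Tendsto V l (𝓝 ((1 + (L - A τ)) * V τ)) := by
  have lim := h.tendsto_homogeneous hM hτ hl
    (((ContinuousLinearMap.mul ℝ (E →L[ℝ] E)).continuous.tendsto L).comp hL)
  simpa [leftMul, add_mul, sub_mul] using lim

/-- The initial value problems posed at either endpoint of `[a, b]` are solvable. -/
def IsSolvable (M : ℝ → ℝ) (A : ℝ → E →L[ℝ] E) (f : ℝ → E) (a b : ℝ) : Prop :=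
  ∀ y, (∃ x, IsSolutionOn M A f x (Icc a b) ∧ x a = y) ∧
    ∃ x, IsSolutionOn M A f x (Icc a b) ∧ x b = y

namespace IsSolvable

theorem trans (h : IsSolvable M A f a v) (h' : IsSolvable M A f v b) (hav : a < v) (hvb : v < b) :
    IsSolvable M A f a b := by
  refine fun y => ⟨?_, ?_⟩
  · obtain ⟨x, hx, hxa⟩ := (h y).1
    obtain ⟨x', hx', hx'v⟩ := (h' (x v)).1
    exact ⟨_, hx.piecewise hx' hav.le hvb.le hx'v.symm, by
      rw [piecewise_eq_of_mem _ _ _ (mem_Iic.2 hav.le), hxa]⟩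
  · obtain ⟨x', hx', hx'b⟩ := (h' y).2
    obtain ⟨x, hx, hxv⟩ := (h (x' v)).2
    exact ⟨_, hx.piecewise hx' hav.le hvb.le hxv, by
      rw [piecewise_eq_of_notMem _ _ _ (notMem_Iic.2 hvb), hx'b]⟩

theorem reflect (h : IsSolvable M A f a b) :
    IsSolvable (fun t => -M (-t)) (fun t => A (-t)) (fun t => f (-t)) (-b) (-a) := by
  refine fun y => ⟨?_, ?_⟩
  · obtain ⟨x, hx, rfl⟩ := (h y).2
    exact ⟨_, hx.reflect, by rw [neg_neg]⟩
  · obtain ⟨x, hx, rfl⟩ := (h y).1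
    exact ⟨_, hx.reflect, by rw [neg_neg]⟩

/-- The solutions on a short interval `[τ, v]` depend on their values at `τ` through an operator
close to the invertible jump factor at `τ`, hence they can be prescribed at `v` instead. -/
theorem eventually_nhdsGT [CompleteSpace E] (hA : IsMajorant M A) (hJ : HasInvertibleJumps A)
    (hf : IsRegularOn M (Icc a b) f) (hτ : τ ∈ Ico a b) :
    ∀ᶠ v in 𝓝[>] τ, IsSolvable M A f τ v := by
  obtain ⟨w, hshort, hw⟩ :=
    ((eventually_isShort hA.monotone τ).and (Ioc_mem_nhdsGT hτ.2)).exists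
  obtain ⟨V, hV, hVτ⟩ := exists_isSolutionOn_of_isShort hA.leftMul (.const 0) hw.1 hshort 1
  obtain ⟨L, hL, hunit⟩ := (hJ τ).2
  have lim := hV.tendsto_leftMul hA.monotone (left_mem_Icc.2 hw.1.le)
    (nhdsGT_le_nhdsWithin_Icc (left_mem_Ico.2 hw.1)) hL
  rw [hVτ, mul_one] at lim
  filter_upwards [lim.eventually (Units.isOpen.mem_nhds hunit), Ioc_mem_nhdsGT hw.1]
    with v ⟨u, hu⟩ hv y
  have hf' := hf.mono_Icc hτ.1 hw.2
  have hsub : Icc τ v ⊆ Icc τ w := Icc_subset_Icc_right hv.2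
  obtain ⟨x, hx, hxτ⟩ := exists_isSolutionOn_of_isShort hA hf' hw.1 hshort y
  refine ⟨⟨x, hx.mono_set hsub, hxτ⟩, ?_⟩
  refine ⟨_, (hx.add_homogeneous (hV.apply ((↑u⁻¹ : E →L[ℝ] E) (y - x v)))).mono_set hsub, ?_⟩
  rw [Pi.add_apply, ← hu, ← mul_apply_eq_comp, Units.mul_inv, one_apply_eq_self,
    add_sub_cancel]

end IsSolvable

theorem isSolvable [CompleteSpace E] (hA : IsMajorant M A) (hJ : HasInvertibleJumps A)
    (hf : IsRegularOn M (Icc a b) f) (hab : a < b) : IsSolvable M A f a b := by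
  refine cousin_induction hab (fun _ _ _ _ huv hvw _ h h' => h.trans h' huv hvw)
    (fun _ hτ => IsSolvable.eventually_nhdsGT hA hJ hf hτ) fun τ hτ => ?_
  have reflected := IsSolvable.eventually_nhdsGT hA.reflect hJ.reflect hf.reflect
    (τ := -τ) ⟨neg_le_neg hτ.2, neg_lt_neg hτ.1⟩
  filter_upwards [tendsto_neg_nhdsLT.eventually reflected] with u hu
  simpa only [neg_neg] using hu.reflect

theorem exists_isSolutionOn_Icc [CompleteSpace E] (hA : IsMajorant M A)
    (hJ : HasInvertibleJumps A) (hf : ∀ a b, IsRegularOn M (Icc a b) f) (hac : a < c) (hcb : c < b)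
    (y : E) : ∃ x, IsSolutionOn M A f x (Icc a b) ∧ x c = y := by
  obtain ⟨x, hx, hxc⟩ := (isSolvable hA hJ (hf a c) hac y).2
  obtain ⟨x', hx', hx'c⟩ := (isSolvable hA hJ (hf c b) hcb y).1
  exact ⟨_, hx.piecewise hx' hac.le hcb.le (hxc.trans hx'c.symm), by
    rw [piecewise_eq_of_mem _ _ _ self_mem_Iic, hxc]⟩

theorem exists_isSolutionOn_univ [CompleteSpace E] (hA : IsMajorant M A)
    (hJ : HasInvertibleJumps A) (hf : ∀ a b, IsRegularOn M (Icc a b) f) (c : ℝ) (y : E) :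
    ∃ x, IsSolutionOn M A f x univ ∧ x c = y := by
  choose! X hX hXc using fun a b (hab : a < c ∧ c < b) =>
    exists_isSolutionOn_Icc hA hJ hf hab.1 hab.2 y
  let x : ℝ → E := fun t => X (min t c - 1) (max t c + 1) t
  have agree {a b : ℝ} (hab : a < c ∧ c < b) : EqOn (X a b) x (Icc a b) := fun t ht => by
    have ht' : min t c - 1 < c ∧ c < max t c + 1 := by grind
    have := (hX a b hab).mono_set (T := Icc (max a (min t c - 1)) (min b (max t c + 1))) (by grind)
    exact this.eqOn hA hJ ((hX _ _ ht').mono_set (by grind)) (c := c) (by grind)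
      ((hXc a b hab).trans (hXc _ _ ht').symm) (by grind)
  refine ⟨x, IsPrimitive.univ_of_forall_Icc fun a b => ?_, hXc _ _ (by grind)⟩
  have hab : min a c - 1 < c ∧ c < max b c + 1 := by grind
  exact ((hX _ _ hab).congr (agree hab)).mono_set (by grind)

end InitialValueProblem

section VariationOfConstants

variable {E : Type*} [NormedAddCommGroup E] [NormedSpace ℝ E] {M : ℝ → ℝ} {A V : ℝ → E →L[ℝ] E}
  {f x : ℝ → E}

theorem IsSolutionOn.ringInverse_isBigO_one [CompleteSpace E] (hM : Monotone M)
    (hJ : HasInvertibleJumps A) (hV : IsSolutionOn M (leftMul A) 0 V univ)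
    (hunit : ∀ t, IsUnit (V t)) (τ : ℝ) :
    (fun t => Ring.inverse (V t)) =O[𝓝[univ] τ] fun _ => (1 : ℝ) := by
  have bounded_along {l : Filter ℝ} (hl : l ≤ 𝓝[univ] τ) (hjump : HasInvertibleJumpAlong l τ A) :
      (fun t => Ring.inverse (V t)) =O[l] fun _ => (1 : ℝ) := by
    obtain ⟨L, hL, hLunit⟩ := hjump
    obtain ⟨u, hu⟩ := hLunit.mul (hunit τ)
    have lim := hV.tendsto_leftMul hM (mem_univ τ) hl hL
    rw [← hu] at lim
    exact ((NormedRing.inverse_continuousAt u).tendsto.comp lim).isBigO_one ℝ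
  refine IsBigO.mono ?_ (nhdsWithin_le_pure_sup_sup univ τ)
  rw [univ_inter, univ_inter]
  exact ((isBigO_pure (x := τ)).2 fun h => absurd h one_ne_zero).sup <|
    (bounded_along (nhdsWithin_mono τ (subset_univ _)) (hJ τ).1).sup
      (bounded_along (nhdsWithin_mono τ (subset_univ _)) (hJ τ).2)

theorem residual_ringInverse (hunit : ∀ t, IsUnit (V t)) (c : E) (τ v : ℝ) :
    residual (fun s => Ring.inverse (V s)) (fun s => f s - c)
        (fun s => Ring.inverse (V s) (f s - c - x s)) τ v =
      Ring.inverse (V v) (residual (leftMul A) V V τ v (Ring.inverse (V τ) (x τ)) -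
        residual A x (x - f) τ v) := by
  have cancel_left (y : E) : Ring.inverse (V v) (V v y) = y := by
    rw [← mul_apply_eq_comp, Ring.inverse_mul_cancel _ (hunit v), one_apply_eq_self]
  have cancel_right : V τ (Ring.inverse (V τ) (x τ)) = x τ := by
    rw [← mul_apply_eq_comp, Ring.mul_inverse_cancel _ (hunit τ), one_apply_eq_self]
  simp only [residual, leftMul, Pi.sub_apply, _root_.sub_apply, ContinuousLinearMap.mul_apply',
    mul_apply_eq_comp, map_sub, cancel_left, cancel_right]
  abel

theorem IsSolutionOn.isPrimitive_ringInverse [CompleteSpace E] (hM : Monotone M)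
    (hJ : HasInvertibleJumps A) (hx : IsSolutionOn M A f x univ)
    (hV : IsSolutionOn M (leftMul A) 0 V univ) (hunit : ∀ t, IsUnit (V t)) (c : E) :
    IsPrimitive M (fun s => Ring.inverse (V s)) (fun s => f s - c)
      (fun s => Ring.inverse (V s) (f s - c - x s)) univ := fun τ hτ => by
  have small : (fun v => residual (leftMul A) V V τ v (Ring.inverse (V τ) (x τ)) -
      residual A x (x - f) τ v) =o[𝓝[univ] τ] fun v => M v - M τ := by
    refine IsLittleO.sub ?_ (hx τ hτ)
    exact (hV.apply (Ring.inverse (V τ) (x τ)) τ hτ).congr_left fun v => by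
      rw [sub_zero, residual_leftMul_apply]
  refine IsBigO.trans_isLittleO (.of_norm_le fun v => ?_) <|
    ((hV.ringInverse_isBigO_one hM hJ hunit τ).norm_left.mul_isLittleO small.norm_left).congr_right
      fun v => one_mul _
  rw [residual_ringInverse hunit c]
  exact ContinuousLinearMap.le_opNorm _ _

end VariationOfConstants

section TransitionMatrix

variable {E : Type*} [NormedAddCommGroup E] [NormedSpace ℝ E] {M : ℝ → ℝ} {A : ℝ → E →L[ℝ] E}
  {U V : ℝ → ℝ → E →L[ℝ] E} {f g F x y : ℝ → E} {s c ω : ℝ}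

theorem IsTransitionMatrix.self (hU : IsTransitionMatrix A U) (s : ℝ) : U s s = 1 :=
  ContinuousLinearMap.ext fun v => sub_eq_zero.1 (hU s s v).eq_zero_of_self

variable [CompleteSpace E]

theorem IsRegularOn.of_hasKSIntegral {a b : ℝ} (hA : IsMajorant M A)
    (h : ∀ t, HasKSIntegral A g s t (F t - F s)) : IsRegularOn M (Icc a b) F :=
  have hA' := isRegularOn_Icc_iff.1 (hA.isRegularOn (Icc a b))
  have hres := tendsto_residual_of_hasKSIntegral h
  isRegularOn_Icc_iff.2 ⟨fun τ hτ => (hA'.1 τ hτ).of_residual (hres τ).2,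
    fun τ hτ => (hA'.2 τ hτ).of_residual (hres τ).1⟩

theorem IsPrimitive.of_hasKSIntegral (hA : IsMajorant M A)
    (hg : ∀ a b, IsRegularOn M (Icc a b) g) (h : ∀ t, HasKSIntegral A g s t (F t - F s)) :
    IsPrimitive M A g F univ := by
  refine IsPrimitive.univ_of_forall_Icc fun a b => ?_
  obtain ⟨a', b', haa', hs, hbb'⟩ : ∃ a' b', a' ≤ a ∧ s ∈ Ioo a' b' ∧ b ≤ b' :=
    ⟨min a (s - 1), max b (s + 1), by grind⟩
  obtain ⟨I, hI⟩ := exists_isPrimitive hA (hg a' b') (hs.1.trans hs.2)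
  refine ((hI.add_const (F s - I s)).congr (fun _ _ => rfl) fun t ht => ?_).mono_set
    (Icc_subset_Icc haa' hbb')
  have increments_eq := (hI.hasKSIntegral hA.monotone ordConnected_Icc (Ioo_subset_Icc_self hs)
    ht).unique (h t)
  rw [add_sub_left_comm, increments_eq, add_sub_cancel]

theorem IsSolutionOn.of_hasKSIntegral (hA : IsMajorant M A)
    (hf : ∀ a b, IsRegularOn M (Icc a b) f)
    (h : ∀ t, HasKSIntegral A x s t (x t - x s - (f t - f s))) : IsSolutionOn M A f x univ := by
  have h' : ∀ t, HasKSIntegral A x s t ((x - f) t - (x - f) s) := fun t => by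
    simpa only [Pi.sub_apply, sub_sub_sub_comm] using h t
  exact IsPrimitive.of_hasKSIntegral hA
    (fun a b => sub_add_cancel x f ▸ (IsRegularOn.of_hasKSIntegral hA h').add (hf a b)) h'

theorem isSolution_iff (hA : IsMajorant M A) (hf : ∀ a b, IsRegularOn M (Icc a b) f) :
    IsSolution A f x ↔ IsSolutionOn M A f x univ := by
  refine ⟨fun h => .of_hasKSIntegral hA hf (h 0), fun h s t => ?_⟩
  rw [sub_sub_sub_comm]
  exact IsPrimitive.hasKSIntegral hA.monotone h ordConnected_univ trivial trivial

theorem IsSolutionOn.eq_of_univ (hA : IsMajorant M A) (hJ : HasInvertibleJumps A)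
    (hx : IsSolutionOn M A f x univ) (hy : IsSolutionOn M A f y univ) (hc : x c = y c) : x = y :=
  funext fun t => (hx.mono_set (subset_univ _)).eqOn hA hJ (hy.mono_set (subset_univ _))
    (left_mem_uIcc (b := t)) hc right_mem_uIcc

namespace IsTransitionMatrix

theorem isSolutionOn (hA : IsMajorant M A) (hU : IsTransitionMatrix A U) (s : ℝ) (v : E) :
    IsSolutionOn M A 0 (fun t => U t s v) univ :=
  .of_hasKSIntegral (s := s) hA (fun _ _ => .const 0) fun t => by
    simpa [hU.self s] using hU t s v

theorem unique (hA : IsMajorant M A) (hJ : HasInvertibleJumps A) (hU : IsTransitionMatrix A U)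
    (hV : IsTransitionMatrix A V) : U = V := by
  ext t s v
  refine congrFun ((hU.isSolutionOn hA s v).eq_of_univ (c := s) hA hJ
    (hV.isSolutionOn hA s v) ?_) t
  rw [hU.self, hV.self]

theorem mul (hA : IsMajorant M A) (hJ : HasInvertibleJumps A) (hU : IsTransitionMatrix A U)
    (t s r : ℝ) : U t s * U s r = U t r := by
  ext v
  refine congrFun ((hU.isSolutionOn hA s (U s r v)).eq_of_univ (c := s) hA hJ
    (hU.isSolutionOn hA r v) ?_) t
  rw [hU.self, one_apply_eq_self]

theorem isUnit (hA : IsMajorant M A) (hJ : HasInvertibleJumps A) (hU : IsTransitionMatrix A U)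
    (t s : ℝ) : IsUnit (U t s) :=
  ⟨⟨U t s, U s t, by rw [hU.mul hA hJ, hU.self], by rw [hU.mul hA hJ, hU.self]⟩, rfl⟩

theorem ringInverse (hA : IsMajorant M A) (hJ : HasInvertibleJumps A)
    (hU : IsTransitionMatrix A U) (t s : ℝ) : Ring.inverse (U t s) = U s t :=
  Ring.inverse_unit
    ⟨U t s, U s t, by rw [hU.mul hA hJ, hU.self], by rw [hU.mul hA hJ, hU.self]⟩

theorem translate (hA : IsMajorant M A) (hJ : HasInvertibleJumps A) (hU : IsTransitionMatrix A U)
    (hω : ∀ s t, A (t + ω) - A (s + ω) = A t - A s) (t s : ℝ) : U (t + ω) (s + ω) = U t s :=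
  have translated : IsTransitionMatrix A fun t s => U (t + ω) (s + ω) := fun t s v =>
    HasKSIntegral.translate hω (hU (t + ω) (s + ω) v)
  congrFun₂ (translated.unique hA hJ hU) t s

end IsTransitionMatrix

theorem exists_isTransitionMatrix (hA : IsMajorant M A) (hJ : HasInvertibleJumps A) :
    ∃ U, IsTransitionMatrix A U ∧ ∀ s, IsSolutionOn M (leftMul A) 0 (fun t => U t s) univ := by
  choose V hV hVs using fun s =>
    exists_isSolutionOn_univ hA.leftMul hJ.leftMul (fun _ _ => .const 0) s 1
  refine ⟨fun t s => V s t, fun t s v => ?_, hV⟩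
  have isSolution := (isSolution_iff hA fun _ _ => .const 0).2 ((hV s).apply v)
  simpa [hVs] using isSolution s t

theorem isTransitionMatrix_transitionMatrix (hA : IsMajorant M A) (hJ : HasInvertibleJumps A) :
    IsTransitionMatrix A (transitionMatrix A) := by
  have h : ∃ U, IsTransitionMatrix A U := (exists_isTransitionMatrix hA hJ).imp fun _ => And.left
  rw [transitionMatrix, dif_pos h]
  exact h.choose_spec

theorem IsTransitionMatrix.isSolutionOn_leftMul (hA : IsMajorant M A) (hJ : HasInvertibleJumps A)
    (hU : IsTransitionMatrix A U) (s : ℝ) :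
    IsSolutionOn M (leftMul A) 0 (fun t => U t s) univ := by
  obtain ⟨V, hV, hVsol⟩ := exists_isTransitionMatrix hA hJ
  exact hU.unique hA hJ hV ▸ hVsol s

theorem IsTransitionMatrix.hasKSIntegral (hA : IsMajorant M A) (hJ : HasInvertibleJumps A)
    (hU : IsTransitionMatrix A U) (hx : IsSolutionOn M A f x univ) (T : ℝ) (c : E) (a b : ℝ) :
    HasKSIntegral (U T) (fun s => f s - c) a b
      (U T b (f b - c - x b) - U T a (f a - c - x a)) := by
  have primitive := hx.isPrimitive_ringInverse hA.monotone hJ (hU.isSolutionOn_leftMul hA hJ T)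
    (fun t => hU.isUnit hA hJ t T) c
  simp only [hU.ringInverse hA hJ] at primitive
  exact primitive.hasKSIntegral hA.monotone ordConnected_univ trivial trivial

end TransitionMatrix

section PeriodicSolution

variable {E : Type*} [NormedAddCommGroup E] [NormedSpace ℝ E] {M : ℝ → ℝ} {A : ℝ → E →L[ℝ] E}
  {U : ℝ → ℝ → E →L[ℝ] E} {f x : ℝ → E} {J : E} {ω : ℝ}

theorem IsRegulated.of_forall_isRegularOn {X : Type*} [NormedAddCommGroup X] {k : ℝ → X}
    (h : ∀ a b, IsRegularOn M (Icc a b) k) : IsRegulated k := fun τ =>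
  ⟨((h (τ - 1) τ).nhdsLT ⟨sub_one_lt τ, le_rfl⟩).1, ((h τ (τ + 1)).nhdsGT ⟨le_rfl, lt_add_one τ⟩).1⟩

theorem IsSolution.translate (hω : ∀ s t, A (t + ω) - A (s + ω) = A t - A s)
    (hfω : Function.Periodic f ω) (hx : IsSolution A f x) :
    IsSolution A f fun t => x (t + ω) := fun s t =>
  HasKSIntegral.translate hω <| by simpa only [hfω s, hfω t] using hx (s + ω) (t + ω)

variable [CompleteSpace E]

theorem existsUnique_isSolution (hA : IsMajorant M A) (hJ : HasInvertibleJumps A)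
    (hf : ∀ a b, IsRegularOn M (Icc a b) f) (c : ℝ) (y : E) :
    ∃! x, IsSolution A f x ∧ x c = y := by
  simp only [isSolution_iff hA hf]
  obtain ⟨x, hx, hxc⟩ := exists_isSolutionOn_univ hA hJ hf c y
  exact ⟨x, ⟨hx, hxc⟩, fun x' hx' => hx'.1.eq_of_univ hA hJ hx (hx'.2.trans hxc.symm)⟩

theorem IsSolution.isRegulated (hA : IsMajorant M A) (hf : ∀ a b, IsRegularOn M (Icc a b) f)
    (hx : IsSolution A f x) : IsRegulated x :=
  .of_forall_isRegularOn fun a b =>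
    (((isSolution_iff hA hf).1 hx).mono_set (subset_univ _)).isRegularOn hA (hf a b)

theorem IsSolution.periodic_iff_apply_eq (hA : IsMajorant M A) (hJ : HasInvertibleJumps A)
    (hf : ∀ a b, IsRegularOn M (Icc a b) f) (hω : ∀ s t, A (t + ω) - A (s + ω) = A t - A s)
    (hfω : Function.Periodic f ω) (hx : IsSolution A f x) :
    Function.Periodic x ω ↔ x ω = x 0 := by
  refine ⟨fun h => h.eq, fun h => congrFun ?_⟩
  refine (existsUnique_isSolution hA hJ hf 0 (x 0)).unique ⟨hx.translate hω hfω, ?_⟩ ⟨hx, rfl⟩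
  rw [zero_add, h]

theorem IsTransitionMatrix.hasKSIntegral_period (hA : IsMajorant M A) (hJ : HasInvertibleJumps A)
    (hf : ∀ a b, IsRegularOn M (Icc a b) f) (hU : IsTransitionMatrix A U)
    (hfω : Function.Periodic f ω) (hx : IsSolution A f x) :
    HasKSIntegral (U ω) (fun s => f s - f 0) 0 ω (U ω 0 (x 0) - x ω) := by
  have integral := hU.hasKSIntegral hA hJ ((isSolution_iff hA hf).1 hx) ω (f 0) 0 ω
  simpa only [hfω.eq, hU.self, one_apply_eq_self, sub_self, zero_sub, map_neg, sub_neg_eq_add,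
    neg_add_eq_sub] using integral

theorem IsSolution.periodic_iff_initial_value (hA : IsMajorant M A) (hJ : HasInvertibleJumps A)
    (hf : ∀ a b, IsRegularOn M (Icc a b) f) (hU : IsTransitionMatrix A U)
    (hω : ∀ s t, A (t + ω) - A (s + ω) = A t - A s) (hfω : Function.Periodic f ω)
    (hunit : IsUnit (1 - U ω 0)) (hint : HasKSIntegral (U ω) (fun s => f s - f 0) 0 ω J)
    (hx : IsSolution A f x) :
    Function.Periodic x ω ↔ x 0 = -(Ring.inverse (1 - U ω 0) J) := by
  rw [hx.periodic_iff_apply_eq hA hJ hf hω hfω,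
    hint.unique (hU.hasKSIntegral_period hA hJ hf hfω hx)]
  have injective := (ContinuousLinearMap.isUnit_iff_bijective.1 hunit).injective
  rw [← injective.eq_iff (a := x 0), map_neg, ← mul_apply_eq_comp, Ring.mul_inverse_cancel _ hunit]
  simp only [_root_.sub_apply, one_apply_eq_self, neg_sub, sub_left_inj]
  exact eq_comm

end PeriodicSolution

section Dichotomy

theorem one_sub_mul_tsum {R : Type*} [Ring R] [TopologicalSpace R] [IsTopologicalRing R]
    [T2Space R] {φ p : R} (h : Summable fun k : ℕ => φ ^ k * p) :
    (1 - φ) * ∑' k : ℕ, φ ^ k * p = p := by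
  rw [sub_mul, one_mul, ← h.tsum_mul_left, h.tsum_eq_zero_add]
  simp only [pow_zero, one_mul, pow_succ', mul_assoc, add_sub_cancel_right]

theorem tsum_mul_one_sub {R : Type*} [Ring R] [TopologicalSpace R] [IsTopologicalRing R]
    [T2Space R] {φ p : R} (h : Summable fun k : ℕ => p * φ ^ k) :
    (∑' k : ℕ, p * φ ^ k) * (1 - φ) = p := by
  rw [mul_sub, mul_one, ← h.tsum_mul_right, h.tsum_eq_zero_add]
  simp only [pow_zero, mul_one, pow_succ, ← mul_assoc, add_sub_cancel_right]

theorem isUnit_one_sub_of_summable {R : Type*} [Ring R] [TopologicalSpace R] [IsTopologicalRing R]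
    [T2Space R] {u : Rˣ} {p : R} (hleft : Summable fun k : ℕ => (u : R) ^ k * p)
    (hleft' : Summable fun k : ℕ => (↑u⁻¹ : R) ^ k * (1 - p))
    (hright : Summable fun k : ℕ => p * (u : R) ^ k)
    (hright' : Summable fun k : ℕ => (1 - p) * (↑u⁻¹ : R) ^ k) : IsUnit (1 - (u : R)) := by
  refine isUnit_iff_exists_and_exists.2 ⟨⟨∑' k : ℕ, (u : R) ^ k * p -
    ↑u⁻¹ * ∑' k : ℕ, (↑u⁻¹ : R) ^ k * (1 - p), ?_⟩, ∑' k : ℕ, p * (u : R) ^ k -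
    (∑' k : ℕ, (1 - p) * (↑u⁻¹ : R) ^ k) * ↑u⁻¹, ?_⟩
  · have one_sub_mul_inv : (1 - (u : R)) * ↑u⁻¹ = -(1 - ↑u⁻¹) := by
      rw [sub_mul, one_mul, Units.mul_inv, neg_sub]
    rw [mul_sub, ← mul_assoc, one_sub_mul_inv, neg_mul, one_sub_mul_tsum hleft,
      one_sub_mul_tsum hleft', sub_neg_eq_add, add_sub_cancel]
  · have inv_mul_one_sub : ↑u⁻¹ * (1 - (u : R)) = -(1 - ↑u⁻¹) := by
      rw [mul_sub, mul_one, Units.inv_mul, neg_sub]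
    rw [sub_mul, mul_assoc, inv_mul_one_sub, mul_neg, tsum_mul_one_sub hright,
      tsum_mul_one_sub hright', sub_neg_eq_add, add_sub_cancel]

variable {E : Type*} [NormedAddCommGroup E] [NormedSpace ℝ E] [CompleteSpace E] {M : ℝ → ℝ}
  {A : ℝ → E →L[ℝ] E} {U : ℝ → ℝ → E →L[ℝ] E} {ω : ℝ}

theorem IsTransitionMatrix.val_zpow (hA : IsMajorant M A) (hJ : HasInvertibleJumps A)
    (hU : IsTransitionMatrix A U) (hω : ∀ s t, A (t + ω) - A (s + ω) = A t - A s)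
    {u : (E →L[ℝ] E)ˣ} (hu : ↑u = U ω 0) (n : ℤ) : ↑(u ^ n) = U (n * ω) 0 := by
  have succ_period (m : ℤ) : U ((m + 1 : ℤ) * ω) 0 = U (m * ω) 0 * u := by
    rw [hu, ← hU.translate hA hJ hω (m * ω) 0, zero_add, hU.mul hA hJ, Int.cast_add, Int.cast_one,
      add_one_mul]
  induction n with
  | zero => simp [hU.self]
  | succ k ih => rw [zpow_add_one, Units.val_mul, ih, succ_period]
  | pred k ih =>
    rw [zpow_sub_one, Units.val_mul, ih, eq_comm, Units.eq_mul_inv_iff_mul_eq, ← succ_period,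
      sub_add_cancel]

theorem summable_of_norm_le_exp {X : Type*} [NormedAddCommGroup X] [CompleteSpace X] {k : ℕ → X}
    {K α : ℝ} (hα : 0 < α) (hω : 0 < ω) (h : ∀ n : ℕ, ‖k n‖ ≤ K * Real.exp (-α * (n * ω))) :
    Summable k := by
  refine .of_norm_bounded (Summable.mul_left K ?_) h
  have ratio_lt_one : Real.exp (-α * ω) < 1 := Real.exp_lt_one_iff.2 (by nlinarith)
  refine (summable_geometric_of_lt_one (Real.exp_pos _).le ratio_lt_one).congr fun n => ?_
  rw [← Real.exp_nat_mul]
  ring_nf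

theorem HasExpDichotomy.isUnit_one_sub (hA : IsMajorant M A) (hJ : HasInvertibleJumps A)
    (hD : HasExpDichotomy A) (hω : 0 < ω) (hAω : ∀ s t, A (t + ω) - A (s + ω) = A t - A s) :
    IsUnit (1 - transitionMatrix A ω 0) := by
  obtain ⟨K, α, P, -, hα, -, stable, unstable⟩ := hD
  have hU := isTransitionMatrix_transitionMatrix hA hJ
  obtain ⟨u, hu⟩ := hU.isUnit hA hJ ω 0
  have stable_zpow (m n : ℤ) (hnm : n ≤ m) :
      ‖(↑(u ^ m) * P * ↑(u ^ n)⁻¹ : E →L[ℝ] E)‖ ≤ K * Real.exp (-α * ((m - n) * ω)) := by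
    have bound := stable (m * ω) (n * ω) (by gcongr)
    rwa [← hU.val_zpow hA hJ hAω hu, ← hU.val_zpow hA hJ hAω hu, Ring.inverse_unit,
      ← sub_mul] at bound
  have unstable_zpow (m n : ℤ) (hmn : m ≤ n) :
      ‖(↑(u ^ m) * (1 - P) * ↑(u ^ n)⁻¹ : E →L[ℝ] E)‖ ≤ K * Real.exp (-α * ((n - m) * ω)) := by
    have bound := unstable (m * ω) (n * ω) (by gcongr)
    rwa [← hU.val_zpow hA hJ hAω hu, ← hU.val_zpow hA hJ hAω hu, Ring.inverse_unit,
      ← sub_mul] at bound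
  rw [← hu]
  refine isUnit_one_sub_of_summable (p := P) ?_ ?_ ?_ ?_ <;>
    refine summable_of_norm_le_exp (K := K) hα hω fun k => ?_
  · simpa using stable_zpow k 0 k.cast_nonneg
  · simpa [← inv_pow] using unstable_zpow (-k) 0 (neg_nonpos.2 k.cast_nonneg)
  · simpa using stable_zpow 0 (-k) (neg_nonpos.2 k.cast_nonneg)
  · simpa [← inv_pow] using unstable_zpow 0 k k.cast_nonneg

end Dichotomy

section Majorant

theorem IsRegulated.eventually_nhdsGT_eventually_dist_lt {X : Type*} [PseudoMetricSpace X]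
    {f : ℝ → X} (hf : IsRegulated f) {ε : ℝ} (hε : 0 < ε) (τ : ℝ) :
    ∀ᶠ t in 𝓝[>] τ, ∀ᶠ s in 𝓝 t, dist (f s) (f t) < ε := by
  obtain ⟨y, hy⟩ := (hf τ).2
  have near := hy.eventually (Metric.ball_mem_nhds y (half_pos hε))
  filter_upwards [near, eventually_eventually_nhdsWithin.2 near, self_mem_nhdsWithin]
    with t ht near_t hτt
  rw [isOpen_Ioi.nhdsWithin_eq hτt] at near_t
  filter_upwards [near_t] with s hs
  calc dist (f s) (f t) ≤ dist (f s) y + dist (f t) y := dist_triangle_right _ _ _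
    _ < ε / 2 + ε / 2 := add_lt_add hs ht
    _ = ε := add_halves ε

theorem IsRegulated.countable_not_continuousAt {X : Type*} [PseudoMetricSpace X] {f : ℝ → X}
    (hf : IsRegulated f) : {t | ¬ContinuousAt f t}.Countable := by
  let D (k : ℕ) : Set ℝ := {t | ¬∀ᶠ s in 𝓝 t, dist (f s) (f t) < 1 / ((k : ℝ) + 1)}
  have isolated (k : ℕ) : ∀ τ ∈ D k, 𝓝[D k ∩ Ioi τ] τ = ⊥ := fun τ _ => by
    rw [inter_comm, nhdsWithin_inter', inf_principal_eq_bot]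
    filter_upwards [hf.eventually_nhdsGT_eventually_dist_lt Nat.one_div_pos_of_nat τ]
      with t ht using not_not_intro ht
  have countable (k : ℕ) : (D k).Countable :=
    countable_setOfPred_isolated_right_within.mono fun τ hτ => mem_sep hτ (isolated k τ hτ)
  refine (countable_iUnion countable).mono fun t ht => ?_
  contrapose! ht
  refine not_not_intro (Metric.tendsto_nhds.2 fun ε hε => ?_)
  obtain ⟨k, hk⟩ := exists_nat_one_div_lt hε
  have hkt : ∀ᶠ s in 𝓝 t, dist (f s) (f t) < 1 / ((k : ℝ) + 1) :=
    not_not.1 fun h => ht (mem_iUnion.2 ⟨k, h⟩)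
  exact hkt.mono fun s hs => hs.trans hk

theorem exists_isFiniteMeasure_singleton_ne_zero {D : Set ℝ} (hD : D.Countable) :
    ∃ μ : Measure ℝ, IsFiniteMeasure μ ∧ ∀ t ∈ D, μ {t} ≠ 0 := by
  have := hD.to_subtype
  refine ⟨(Measure.sum fun d : D => Measure.dirac (d : ℝ)).toFinite, inferInstance,
    fun t ht h₀ => ?_⟩
  have sum_zero := absolutelyContinuous_toFinite _ h₀
  simpa using Measure.sum_apply_eq_zero.1 sum_zero ⟨t, ht⟩

theorem exists_monotone_forall_not_tendsto {D : Set ℝ} (hD : D.Countable) :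
    ∃ N : ℝ → ℝ, Monotone N ∧
      ∀ t ∈ D, ∀ l ≤ 𝓝[≠] t, l.NeBot → ¬Tendsto N l (𝓝 (N t)) := by
  obtain ⟨μ, hμ, hμD⟩ := exists_isFiniteMeasure_singleton_ne_zero hD
  have mono {R T : Set ℝ} (h : R ⊆ T) : μ.real R ≤ μ.real T := measureReal_mono h
  have jump (t : ℝ) : μ.real (Iic t) = μ.real (Iio t) + μ.real {t} := by
    rw [← Iio_union_right, measureReal_union (by simp) (measurableSet_singleton t)]
  refine ⟨fun t => μ.real (Iio t) + μ.real (Iic t), fun s t hst =>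
    add_le_add (mono (Iio_subset_Iio hst)) (mono (Iic_subset_Iic.2 hst)), fun t ht l hl _ lim => ?_⟩
  have hpos : 0 < μ.real {t} := ENNReal.toReal_pos (hμD t ht) (measure_ne_top μ _)
  obtain ⟨s, hs, hst⟩ :=
    ((lim.eventually (Metric.ball_mem_nhds _ hpos)).and (hl self_mem_nhdsWithin)).exists
  simp only [Real.dist_eq, abs_lt] at hs
  rcases lt_or_gt_of_ne hst with h | h
  · linarith [jump t, mono (Iio_subset_Iio h.le), mono (Iic_subset_Iio.2 h)]
  · linarith [jump t, mono (Iic_subset_Iio.2 h), mono (Iic_subset_Iic.2 h.le)]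

variable {X Y : Type*} [NormedAddCommGroup X] [NormedAddCommGroup Y] {M N : ℝ → ℝ}
  {k : ℝ → X} {f : ℝ → Y}

theorem isMajorant_of_monotone (hM : Monotone M) (h : ∀ s t, s ≤ t → ‖k t - k s‖ ≤ M t - M s) :
    IsMajorant M k where
  monotone := hM
  norm_sub_le s t := by
    rcases le_total s t with hst | hts
    · exact (h s t hst).trans (le_abs_self _)
    · rw [norm_sub_rev, abs_sub_comm]
      exact (h t s hts).trans (le_abs_self _)

theorem isMajorant_variationOnFromTo (hk : LocallyBoundedVariationOn k univ) :
    IsMajorant (variationOnFromTo k univ 0) k := by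
  refine isMajorant_of_monotone (monotoneOn_univ.1 (variationOnFromTo.monotoneOn hk (mem_univ 0)))
    fun s t hst => ?_
  rw [variationOnFromTo.sub_right hk (mem_univ _) (mem_univ _) (mem_univ _),
    variationOnFromTo.eq_of_le _ _ hst, ← dist_eq_norm, dist_edist]
  exact ENNReal.toReal_mono (hk s t (mem_univ _) (mem_univ _))
    (eVariationOn.edist_le k ⟨mem_univ _, hst, le_rfl⟩ ⟨mem_univ _, le_rfl, hst⟩)

theorem IsMajorant.self_of_monotone (hN : Monotone N) : IsMajorant N N :=
  ⟨hN, fun _ _ => le_rfl⟩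

theorem IsMajorant.add_monotone (h : IsMajorant M k) (hN : Monotone N) : IsMajorant (M + N) k :=
  isMajorant_of_monotone (h.monotone.add hN) fun s t hst =>
    calc ‖k t - k s‖ ≤ |M t - M s| := h.norm_sub_le s t
      _ = M t - M s := abs_of_nonneg (sub_nonneg.2 (h.monotone hst))
      _ ≤ M t - M s + (N t - N s) := le_add_of_nonneg_right (sub_nonneg.2 (hN hst))
      _ = M t + N t - (M s + N s) := by ring

theorem exists_isMajorant_isRegularOn (hk : LocallyBoundedVariationOn k univ) (hf : IsRegulated f) :
    ∃ M, IsMajorant M k ∧ ∀ a b, IsRegularOn M (Icc a b) f := by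
  obtain ⟨N, hN, hjump⟩ := exists_monotone_forall_not_tendsto hf.countable_not_continuousAt
  have hV := isMajorant_variationOnFromTo hk
  set V := variationOnFromTo k univ 0
  have majorant_N : IsMajorant (V + N) N :=
    add_comm N V ▸ (IsMajorant.self_of_monotone hN).add_monotone hV.monotone
  have regular (l : Filter ℝ) (τ : ℝ) (hl : l ≤ 𝓝[≠] τ) [l.NeBot] (hy : ∃ y, Tendsto f l (𝓝 y)) :
      IsRegularAlong (V + N) l τ f := by
    refine ⟨hy, fun lim => ?_⟩
    have continuousAt : ContinuousAt f τ := not_not.1 fun h =>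
      hjump τ h l hl ‹_› ((IsRegularAlong.of_isMajorant majorant_N lim).2 lim)
    exact continuousAt.tendsto.mono_left (hl.trans nhdsWithin_le_nhds)
  exact ⟨V + N, hV.add_monotone hN, fun a b => isRegularOn_Icc_iff.2
    ⟨fun τ _ => regular _ τ (nhdsGT_le_nhdsNE τ) (hf τ).2,
     fun τ _ => regular _ τ (nhdsLT_le_nhdsNE τ) (hf τ).1⟩⟩

theorem ConditionH.hasInvertibleJumps {E : Type*} [NormedAddCommGroup E] [NormedSpace ℝ E]
    [CompleteSpace E] {A : ℝ → E →L[ℝ] E} (hH : ConditionH A) (hA : IsMajorant M A) :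
    HasInvertibleJumps A := fun τ => by
  obtain ⟨left, hleft⟩ := (IsRegularAlong.of_isMajorant (τ := τ) hA
    (hA.monotone.tendsto_nhdsLT τ)).1
  obtain ⟨right, hright⟩ := (IsRegularAlong.of_isMajorant (τ := τ) hA
    (hA.monotone.tendsto_nhdsGT τ)).1
  refine ⟨⟨left, hleft, ?_⟩, right, hright, ?_⟩
  · rw [← neg_sub, ← sub_eq_add_neg, ← leftLim_eq_of_tendsto hleft]
    exact (hH τ).1
  · rw [← rightLim_eq_of_tendsto hright]
    exact (hH τ).2

end Majorant

end GLDE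

theorem mainTheorem2_general {E : Type*} [NormedAddCommGroup E] [NormedSpace ℝ E]
    [CompleteSpace E] (A : ℝ → E →L[ℝ] E) (C : E →L[ℝ] E) (f : ℝ → E) (ω : ℝ) (hω : 0 < ω)
    (hA : LocallyBoundedVariationOn A Set.univ) (hAC : ∀ t : ℝ, A (t + ω) - A t = C)
    (hf : GLDE.IsRegulated f) (hfω : Function.Periodic f ω)
    (hH : GLDE.ConditionH A) (hD : GLDE.HasExpDichotomy A) :
    (GLDE.IsTransitionMatrix A (GLDE.transitionMatrix A) ∧
      ∀ V, GLDE.IsTransitionMatrix A V → V = GLDE.transitionMatrix A) ∧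
    (∃! x : ℝ → E, GLDE.IsSolution A f x ∧ Function.Periodic x ω) ∧
    IsUnit (1 - GLDE.transitionMatrix A ω 0) ∧
    ∃ J : E,
      GLDE.HasKSIntegral (fun s => GLDE.transitionMatrix A ω s) (fun s => f s - f 0) 0 ω J ∧
      ∃ x : ℝ → E,
        GLDE.IsRegulated x ∧ GLDE.IsSolution A f x ∧ Function.Periodic x ω ∧
        x 0 = -(Ring.inverse (1 - GLDE.transitionMatrix A ω 0) J) ∧
        ∀ y : ℝ → E, GLDE.IsSolution A f y →
          y 0 = -(Ring.inverse (1 - GLDE.transitionMatrix A ω 0) J) → y = x := by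
  obtain ⟨M, hM, hfM⟩ := GLDE.exists_isMajorant_isRegularOn hA hf
  have hJ := hH.hasInvertibleJumps hM
  have hAω (s t : ℝ) : A (t + ω) - A (s + ω) = A t - A s := by
    rw [sub_eq_sub_iff_sub_eq_sub, hAC, hAC]
  have hU := GLDE.isTransitionMatrix_transitionMatrix hM hJ
  have hunit := hD.isUnit_one_sub hM hJ hω hAω
  obtain ⟨x₀, ⟨hx₀, -⟩, -⟩ := GLDE.existsUnique_isSolution hM hJ hfM 0 0
  have hint := hU.hasKSIntegral_period hM hJ hfM hfω hx₀
  set J := GLDE.transitionMatrix A ω 0 (x₀ 0) - x₀ ω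
  have periodic_iff {x : ℝ → E} (hx : GLDE.IsSolution A f x) : Function.Periodic x ω ↔
      x 0 = -(Ring.inverse (1 - GLDE.transitionMatrix A ω 0) J) :=
    hx.periodic_iff_initial_value hM hJ hfM hU hAω hfω hunit hint
  obtain ⟨x, ⟨hx, hx0⟩, unique⟩ := GLDE.existsUnique_isSolution hM hJ hfM 0
    (-(Ring.inverse (1 - GLDE.transitionMatrix A ω 0) J))
  exact ⟨⟨hU, fun V hV => hV.unique hM hJ hU⟩,
    ⟨x, ⟨hx, (periodic_iff hx).2 hx0⟩, fun y hy => unique y ⟨hy.1, (periodic_iff hy.1).1 hy.2⟩⟩,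
    hunit, J, hint, x, hx.isRegulated hM hfM, hx, (periodic_iff hx).2 hx0, hx0,
    fun y hy hy0 => unique y ⟨hy, hy0⟩⟩

theorem mainTheorem2 (n : ℕ)
    (A : ℝ → EuclideanSpace ℝ (Fin n) →L[ℝ] EuclideanSpace ℝ (Fin n))
    (C : EuclideanSpace ℝ (Fin n) →L[ℝ] EuclideanSpace ℝ (Fin n))
    (f : ℝ → EuclideanSpace ℝ (Fin n)) (ω : ℝ) (hω : 0 < ω)
    (hA : LocallyBoundedVariationOn A Set.univ)
    (hAC : ∀ t : ℝ, A (t + ω) - A t = C)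
    (hf : GLDE.IsRegulated f) (hfω : Function.Periodic f ω)
    (hH : GLDE.ConditionH A) (hD : GLDE.HasExpDichotomy A) :
    -- the transition matrix exists and is unique
    (GLDE.IsTransitionMatrix A (GLDE.transitionMatrix A) ∧
      ∀ V, GLDE.IsTransitionMatrix A V → V = GLDE.transitionMatrix A) ∧
    -- there is exactly one periodic solution
    (∃! x : ℝ → EuclideanSpace ℝ (Fin n),
      GLDE.IsSolution A f x ∧ Function.Periodic x ω) ∧
    -- it is regulated, and it is the unique solution with the stated initial value
    IsUnit (1 - GLDE.transitionMatrix A ω 0) ∧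
    ∃ J : EuclideanSpace ℝ (Fin n),
      GLDE.HasKSIntegral (fun s => GLDE.transitionMatrix A ω s) (fun s => f s - f 0) 0 ω J ∧
      ∃ x : ℝ → EuclideanSpace ℝ (Fin n),
        GLDE.IsRegulated x ∧ GLDE.IsSolution A f x ∧ Function.Periodic x ω ∧
        x 0 = -(Ring.inverse (1 - GLDE.transitionMatrix A ω 0) J) ∧
        ∀ y : ℝ → EuclideanSpace ℝ (Fin n), GLDE.IsSolution A f y →
          y 0 = -(Ring.inverse (1 - GLDE.transitionMatrix A ω 0) J) → y = x :=
  mainTheorem2_general A C f ω hω hA hAC hf hfω hH hD
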